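/- Let $\mathbf{k}$ be a field. For a set $Z$ let $\mathcal{M}(Z)$ be the free monoid on $Z$, and let $\mathfrak{M}(Z)$ be the free operated monoid on $Z$, i.e. the free monoid with a map $u\mapsto\lfloor u\rfloor$ to itself, so that $\mathbf{k}\mathfrak{M}(Z)$ is the free unital operated algebra on $Z$ (a unital operated algebra is a unital $\mathbf{k}$-algebra with a $\mathbf{k}$-linear operator). The breadth $|u|$ of $u \in \mathfrak{M}(Z)$ is the number of its factors in $Z\cup\lfloor\mathfrak{M}(Z)\rfloor$. Let $\mathfrak{M}^\star(Z)$ be the set of $q\in\mathfrak{M}(Z\cup\{\star\})$ in which $\star$ occurs exactly once. For $q \in \mathfrak{M}^\star(Z)$ and $u \in \mathfrak{M}(Z)$ let $q|_u$ be $q$ with $\star$ replaced by $u$, extended linearly to $q|_s$ for $s\in\mathbf{k}\mathfrak{M}(Z)$; $u$ is a subword of $w$ if $w=q|_u$ for some $q\in\mathfrak{M}^\star(Z)$. A monomial order on $\mathfrak{M}(Z)$ is a well-order $\le$ such that $u<v$ implies $q|_u<q|_v$ for all $q\in\mathfrak{M}^\star(Z)$. Given a linear order on monomials, $\bar f$ is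 the largest monomial occurring in $f\neq 0$, and $\bar 0=1$. An element $f$ is trivial modulo $(\mathcal{G},w)$ if $f=\sum_i c_i\,q_i|_{s_i}$ (a finite sum) with $c_i\in\mathbf{k}$, $s_i\in\mathcal{G}$, $q_i|_{\overline{s_i}}<w$. A set $\mathcal{G}\subseteq\mathbf{k}\mathfrak{M}(Z)$ is an operated GS basis if, for all nonzero $f,g\in\mathcal{G}$, divided by their leading coefficients, the compositions $fu-vg$ (for $w=\bar fu=v\bar g$ with $\max\{|\bar f|,|\bar g|\}<|w|<|\bar f|+|\bar g|$) and $f-q|_g$ (for $w=\bar f=q|_{\bar g}$) are trivial modulo $(\mathcal{G},w)$. GS bases in $\mathbf{k}\mathcal{M}(Z)$ are defined in the same way, with $q$ of the form $a\star b$, $a,b\in\mathcal{M}(Z)$. Put $$\operatorname{Irr}(\mathcal{G})=\mathfrak{M}(Z)\setminus\{q|_{\bar s} : 0\neq s\in\mathcal{G},\ q\in\mathfrak{M}^\star(Z)\}.$$ Let $X,Z$ be sets and let $\Phi\subseteq\mathbf{k}\mathfrak{M}(X)$ be a set of multilinear operated polynomial identities $\phi(x_1,\dots,x_n)$, $n\ge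 1$ (each monomial of $\phi$ contains each of the distinct variables $x_1,\dots,x_n$ exactly once, and no other variable). Put $S_\Phi(Z)=\{\phi(u_1,\dots,u_n) : \phi\in\Phi,\ u_1,\dots,u_n\in\mathfrak{M}(Z)\}$. A $\Phi$-algebra is a unital operated algebra $B$ in which $\phi(b_1,\dots,b_n)=0$ for all $\phi\in\Phi$ and $b_1,\dots,b_n\in B$. Let $I_A$ be a two-sided ideal of $\mathbf{k}\mathcal{M}(Z)$ and $A=\mathbf{k}\mathcal{M}(Z)/I_A$. Let $\le$ be a monomial order on $\mathfrak{M}(Z)$ such that $S_\Phi(Z)$ is an operated GS basis, and let $G$ be a GS basis in $\mathbf{k}\mathcal{M}(Z)$, with respect to the restriction of $\le$ to $\mathcal{M}(Z)$, which generates the ideal $I_A$. Fix a linear order on $\mathfrak{M}(X)$, with respect to which the leading monomials $\bar\phi$ of the $\phi\in\Phi$ are taken, and suppose that for every $\phi=\phi(x_1,\dots,x_n)\in\Phi$ 1. $\bar\phi$ has no subword in $\mathcal{M}(X)$ of length at least $2$; 2. for all $u_1,\dots,u_n\in\mathfrak{M}(Z)$, either $\phi(u_1,\dots,u_n)=0$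 or the leading monomial of $\phi(u_1,\dots,u_n)$ with respect to $\le$ is $\bar\phi(u_1,\dots,u_n)$. Let $\langle S_\Phi(Z)\cup I_A\rangle$ be the operated ideal (two-sided ideal closed under the operator) of $\mathbf{k}\mathfrak{M}(Z)$ generated by $S_\Phi(Z)\cup I_A$, and let $\eta:\mathbf{k}\mathfrak{M}(Z)\to\mathbf{k}\mathfrak{M}(Z)/\langle S_\Phi(Z)\cup I_A\rangle$ be the quotient map. Then $\mathbf{k}\mathfrak{M}(Z)/\langle S_\Phi(Z)\cup I_A\rangle$, with the homomorphism from $A$ induced by $\mathbf{k}\mathcal{M}(Z)\subseteq\mathbf{k}\mathfrak{M}(Z)$, is the free $\Phi$-algebra over the unital algebra $A$, and the elements $\eta(w)$, $w\in\operatorname{Irr}(S_\Phi(Z)\cup G)$, are pairwise distinct and form a $\mathbf{k}$-basis of it. -/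

import Mathlib

noncomputable section

/-! ### Operated words and the free unital operated algebra -/

/-- Operated words on a set `Z`, i.e. the elements of the free operated monoid `𝔐(Z)`.
Every such word is in a unique way either the empty word `1`, or `z · w` with a letter `z ∈ Z`,
or `⌊u⌋ · w`, where `u` and `w` are operated words. -/
inductive OpWord (Z : Type*) where
  | one : OpWord Z
  | letter (z : Z) (w : OpWord Z) : OpWord Z
  | bracket (u w : OpWord Z) : OpWord Z

namespace OpWord

/-- Concatenation of operated words. -/
def append {Z : Type*} : OpWord Z → OpWord Z → OpWord Z
  | one, v => v
  | letter z w, v => letter z (append w v)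
  | bracket u w, v => bracket u (append w v)

theorem append_one {Z : Type*} (u : OpWord Z) : append u one = u := by
  induction u with
  | one => rfl
  | letter z w ih => simp [append, ih]
  | bracket u w _ ih => simp [append, ih]

theorem append_assoc {Z : Type*} (u v w : OpWord Z) :
    append (append u v) w = append u (append v w) := by
  induction u with
  | one => rfl
  | letter z t ih => simp [append, ih]
  | bracket s t _ ih => simp [append, ih]

/-- `𝔐(Z)` is a monoid under concatenation, with the empty word as unit. -/
instance {Z : Type*} : Monoid (OpWord Z) where
  mul := append
  one := one
  mul_assoc := append_assoc
  one_mul _ := rfl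
  mul_one := append_one

/-- The letter `z`, as a word. -/
def of {Z : Type*} (z : Z) : OpWord Z := letter z 1

/-- The operator `u ↦ ⌊u⌋` of the operated monoid `𝔐(Z)`. -/
def brk {Z : Type*} (u : OpWord Z) : OpWord Z := bracket u 1

/-- The breadth of a word: the number of its factors in `Z ∪ ⌊𝔐(Z)⌋`. -/
def breadth {Z : Type*} : OpWord Z → ℕ
  | one => 0
  | letter _ w => breadth w + 1
  | bracket _ w => breadth w + 1

open Classical in
/-- The number of occurrences of the letter `z` in a word, at any bracket depth. -/
def count {Z : Type*} (z : Z) : OpWord Z → ℕ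
  | one => 0
  | letter y w => (if y = z then 1 else 0) + count z w
  | bracket u w => count z u + count z w

/-- The underlying function of `OpWord.lift`. -/
def liftFun {Z M : Type*} [Monoid M] (P : M → M) (θ : Z → M) : OpWord Z → M
  | one => 1
  | letter z w => θ z * liftFun P θ w
  | bracket u w => P (liftFun P θ u) * liftFun P θ w

/-- The morphism of operated monoids from `𝔐(Z)` to a monoid `M` with an operator `P` which
extends a map `θ : Z → M`. -/
def lift {Z M : Type*} [Monoid M] (P : M → M) (θ : Z → M) : OpWord Z →* M where
  toFun := liftFun P θ
  map_one' := rfl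
  map_mul' u v := by
    change liftFun P θ (append u v) = liftFun P θ u * liftFun P θ v
    induction u with
    | one => simp [append, liftFun]
    | letter z w ih => simp [append, liftFun, ih, mul_assoc]
    | bracket s w _ ih => simp [append, liftFun, ih, mul_assoc]

/-- `m(u₁, …, uₙ)`: substitution of the words `θ x` for the letters `x` of a word `m`. -/
def subst {X Z : Type*} (θ : X → OpWord Z) : OpWord X →* OpWord Z := lift brk θ

/-- The inclusion of the free monoid `𝓜(Z)` in `𝔐(Z)`. -/
def ofFree (Z : Type*) : FreeMonoid Z →* OpWord Z := FreeMonoid.lift of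

theorem ofFree_injective (Z : Type*) : Function.Injective (ofFree Z) := by
  have key : ∀ (z : Z) (v : FreeMonoid Z),
      ofFree Z (FreeMonoid.of z * v) = letter z (ofFree Z v) := by
    intro z v
    rw [map_mul]
    rfl
  intro u
  induction u using FreeMonoid.inductionOn' with
  | one =>
    intro v h
    induction v using FreeMonoid.inductionOn' with
    | one => rfl
    | of_mul z v _ =>
      rw [key, map_one] at h
      cases h
  | of_mul y u ih =>
    intro v h
    induction v using FreeMonoid.inductionOn' with
    | one =>
      rw [key, map_one] at h
      cases h
    | of_mul z v _ =>
      rw [key, key] at h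
      injection h with h1 h2
      rw [h1, ih h2]

end OpWord

/-- `𝔐^⋆(Z)`: the words on `Z ∪ {⋆}` in which `⋆` occurs exactly once (`none` plays the
role of `⋆`). -/
def StarWord (Z : Type*) : Type _ := {q : OpWord (Option Z) // q.count none = 1}

namespace StarWord

/-- `q|_u`: the symbol `⋆` in `q` is replaced by `u`. -/
def fill {Z : Type*} (q : StarWord Z) (u : OpWord Z) : OpWord Z :=
  OpWord.subst (fun o : Option Z => o.elim u OpWord.of) q.1

/-- `q|_s` for an element `s` of `k𝔐(Z)`: the linear extension of `u ↦ q|_u`. -/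
def fillLin {k Z : Type*} [Field k] (q : StarWord Z) :
    MonoidAlgebra k (OpWord Z) →ₗ[k] MonoidAlgebra k (OpWord Z) :=
  MonoidAlgebra.mapDomainLinearMap k k q.fill

end StarWord

/-- `u` is a subword of `w`. -/
def IsSubword {Z : Type*} (u w : OpWord Z) : Prop := ∃ q : StarWord Z, w = q.fill u

/-- The free unital operated algebra `k𝔐(Z)` generated by the set `Z`. -/
abbrev FreeOpAlg (k Z : Type*) [Field k] : Type _ := MonoidAlgebra k (OpWord Z)

/-- The operator `⌊ ⌋` of `k𝔐(Z)`, extended linearly from words. -/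
def FreeOpAlg.op (k Z : Type*) [Field k] : FreeOpAlg k Z →ₗ[k] FreeOpAlg k Z :=
  MonoidAlgebra.mapDomainLinearMap k k OpWord.brk

/-- The inclusion of the free unital algebra `k𝓜(Z)` in `k𝔐(Z)`. -/
def freeAlgIncl (k Z : Type*) [Field k] :
    MonoidAlgebra k (FreeMonoid Z) →ₐ[k] FreeOpAlg k Z :=
  MonoidAlgebra.mapDomainAlgHom k k (OpWord.ofFree Z)

/-! ### Operated polynomial identities

A unital operated algebra is a unital `k`-algebra `A` together with a `k`-linear map
`P : A →ₗ[k] A`. -/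

/-- `φ(r₁, …, rₙ)`: the value of `φ ∈ k𝔐(X)` under the morphism of unital operated algebras
`k𝔐(X) → (A, P)` which extends `θ : X → A`. -/
def evalOPI {k X A : Type*} [Field k] [Ring A] [Algebra k A] (P : A →ₗ[k] A) (θ : X → A) :
    FreeOpAlg k X →ₐ[k] A :=
  MonoidAlgebra.lift k A (OpWord X) (OpWord.lift P θ)

/-- `φ = φ(x₁, …, xₙ)`, with `n ≥ 1` distinct variables, is a multilinear operated polynomial
identity: each of its monomials contains each of `x₁, …, xₙ` exactly once, and no other
variable. -/
def IsMultilinearOPI {k X : Type*} [Field k] (φ : FreeOpAlg k X) : Prop :=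
  ∃ V : Finset X, V.Nonempty ∧
    ∀ m ∈ φ.coeff.support, (∀ x ∈ V, m.count x = 1) ∧ ∀ x ∉ V, m.count x = 0

/-- `(A, P)` is a `Φ`-algebra: it satisfies all the identities in `Φ`. -/
def IsPhiAlgebra {k X A : Type*} [Field k] [Ring A] [Algebra k A] (Φ : Set (FreeOpAlg k X))
    (P : A →ₗ[k] A) : Prop :=
  ∀ φ ∈ Φ, ∀ θ : X → A, evalOPI P θ φ = 0

/-- `φ(u₁, …, uₙ) ∈ k𝔐(Z)` for words `u₁, …, uₙ ∈ 𝔐(Z)`. -/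
def substOPI {k X Z : Type*} [Field k] (θ : X → OpWord Z) : FreeOpAlg k X →ₐ[k] FreeOpAlg k Z :=
  evalOPI (FreeOpAlg.op k Z) (fun x => MonoidAlgebra.of k (OpWord Z) (θ x))

/-- `S_Φ(Z) = {φ(u₁, …, uₙ) | u₁, …, uₙ ∈ 𝔐(Z), φ ∈ Φ}`. -/
def SPhi {k X : Type*} [Field k] (Φ : Set (FreeOpAlg k X)) (Z : Type*) : Set (FreeOpAlg k Z) :=
  {f | ∃ φ ∈ Φ, ∃ θ : X → OpWord Z, f = substOPI θ φ}

/-! ### Operated ideals and quotients -/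

/-- The operated ideal of `(A, P)` generated by a subset `S`: the smallest two-sided ideal which
contains `S` and is closed under `P`. -/
def operatedSpan {k A : Type*} [Field k] [Ring A] [Algebra k A] (P : A →ₗ[k] A) (S : Set A) :
    TwoSidedIdeal A :=
  sInf {I : TwoSidedIdeal A | S ⊆ I ∧ ∀ a ∈ I, P a ∈ I}

theorem operatedSpan_op_mem {k A : Type*} [Field k] [Ring A] [Algebra k A] (P : A →ₗ[k] A)
    (S : Set A) {a : A} (ha : a ∈ operatedSpan P S) : P a ∈ operatedSpan P S := by
  rw [operatedSpan, TwoSidedIdeal.mem_sInf] at ha ⊢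
  exact fun I hI => hI.2 a (ha I hI)

/-- The quotient algebra of `(A, P)` by the operated ideal generated by `S`. -/
abbrev OpQuot {k A : Type*} [Field k] [Ring A] [Algebra k A] (P : A →ₗ[k] A) (S : Set A) :
    Type _ :=
  (operatedSpan P S).ringCon.Quotient

/-- The quotient map onto `OpQuot P S`. -/
def OpQuot.mk {k A : Type*} [Field k] [Ring A] [Algebra k A] (P : A →ₗ[k] A) (S : Set A) :
    A →ₐ[k] OpQuot P S :=
  (operatedSpan P S).ringCon.mkₐ (α := k)

/-- The operator induced by `P` on `OpQuot P S`. -/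
def OpQuot.op {k A : Type*} [Field k] [Ring A] [Algebra k A] (P : A →ₗ[k] A) (S : Set A) :
    OpQuot P S →ₗ[k] OpQuot P S where
  toFun := Quotient.map' P (by
    intro a b hab
    have h : a - b ∈ operatedSpan P S := (TwoSidedIdeal.rel_iff _ a b).1 hab
    have h' := operatedSpan_op_mem P S h
    rw [map_sub] at h'
    exact (TwoSidedIdeal.rel_iff _ (P a) (P b)).2 h')
  map_add' x y := by
    induction x using Quotient.inductionOn'
    induction y using Quotient.inductionOn'
    exact congrArg (OpQuot.mk P S) (P.map_add _ _)
  map_smul' c x := by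
    induction x using Quotient.inductionOn'
    exact congrArg (OpQuot.mk P S) (P.map_smul c _)

/-- The unital operated algebra `(F, P)`, together with the homomorphism of unital algebras
`ι : A → F`, is the free `Φ`-algebra over the unital algebra `A`. -/
def IsFreePhiAlgebra.{uk, ux, ua, uf, ub} {k : Type uk} {X : Type ux} {A : Type ua} {F : Type uf}
    [Field k] [Ring A] [Algebra k A] [Ring F] [Algebra k F]
    (Φ : Set (FreeOpAlg k X)) (P : F →ₗ[k] F) (ι : A →ₐ[k] F) : Prop :=
  IsPhiAlgebra Φ P ∧
    ∀ (B : Type ub) [Ring B] [Algebra k B] (PB : B →ₗ[k] B), IsPhiAlgebra Φ PB →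
      ∀ f : A →ₐ[k] B, ∃! g : F →ₐ[k] B, (∀ a, g (P a) = PB (g a)) ∧ g.comp ι = f

/-- The set of relations `S_Φ(Z) ∪ I_A` in `k𝔐(Z)`, for an ideal `I_A` of `k𝓜(Z)`. -/
def phiRel {k X Z : Type*} [Field k] (Φ : Set (FreeOpAlg k X))
    (IA : TwoSidedIdeal (MonoidAlgebra k (FreeMonoid Z))) : Set (FreeOpAlg k Z) :=
  SPhi Φ Z ∪ {f | ∃ a ∈ IA, f = freeAlgIncl k Z a}

/-- The unital algebra `k𝔐(Z) / ⟨S_Φ(Z) ∪ I_A⟩`. -/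
abbrev PhiQuot {k X Z : Type*} [Field k] (Φ : Set (FreeOpAlg k X))
    (IA : TwoSidedIdeal (MonoidAlgebra k (FreeMonoid Z))) : Type _ :=
  OpQuot (FreeOpAlg.op k Z) (phiRel Φ IA)

/-- The quotient map `η : k𝔐(Z) → k𝔐(Z) / ⟨S_Φ(Z) ∪ I_A⟩`. -/
def PhiQuot.mk {k X Z : Type*} [Field k] (Φ : Set (FreeOpAlg k X))
    (IA : TwoSidedIdeal (MonoidAlgebra k (FreeMonoid Z))) :
    FreeOpAlg k Z →ₐ[k] PhiQuot Φ IA :=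
  OpQuot.mk (FreeOpAlg.op k Z) (phiRel Φ IA)

/-- The operator of `k𝔐(Z) / ⟨S_Φ(Z) ∪ I_A⟩`. -/
def PhiQuot.op {k X Z : Type*} [Field k] (Φ : Set (FreeOpAlg k X))
    (IA : TwoSidedIdeal (MonoidAlgebra k (FreeMonoid Z))) :
    PhiQuot Φ IA →ₗ[k] PhiQuot Φ IA :=
  OpQuot.op (FreeOpAlg.op k Z) (phiRel Φ IA)

/-! ### Leading monomials -/

/-- The leading monomial of `f`: the largest monomial which appears in `f`; by convention it is
`1` for `f = 0`. -/
def leadMon {k M : Type*} [Field k] [Monoid M] (o : LinearOrder M) (f : MonoidAlgebra k M) : M :=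
  letI := o
  if h : f.coeff.support.Nonempty then f.coeff.support.max' h else 1

/-- The leading coefficient of `f`. -/
def leadCoeff {k M : Type*} [Field k] [Monoid M] (o : LinearOrder M) (f : MonoidAlgebra k M) : k :=
  f.coeff (leadMon o f)

/-- `f` divided by its leading coefficient. -/
def monicize {k M : Type*} [Field k] [Monoid M] (o : LinearOrder M) (f : MonoidAlgebra k M) :
    MonoidAlgebra k M :=
  (leadCoeff o f)⁻¹ • f

/-! ### Gröbner–Shirshov bases for associative algebras -/

/-- `f` is trivial modulo `(G, w)` in `k𝓜(Z)`: it is a linear combination of elements `a s b`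
with `s ∈ G`, `a, b ∈ 𝓜(Z)` and `a s̄ b < w`. -/
def IsTrivialModAssoc {k Z : Type*} [Field k] (o : LinearOrder (FreeMonoid Z))
    (G : Set (MonoidAlgebra k (FreeMonoid Z))) (w : FreeMonoid Z)
    (f : MonoidAlgebra k (FreeMonoid Z)) : Prop :=
  f ∈ Submodule.span k {h | ∃ s ∈ G, ∃ a b : FreeMonoid Z, o.lt (a * leadMon o s * b) w ∧
    h = MonoidAlgebra.of k _ a * s * MonoidAlgebra.of k _ b}

/-- `G` is a Gröbner–Shirshov basis in `k𝓜(Z)`: all intersection compositions and all inclusion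
compositions of (monicized nonzero) elements of `G` are trivial. -/
def IsGSBasisAssoc {k Z : Type*} [Field k] (o : LinearOrder (FreeMonoid Z))
    (G : Set (MonoidAlgebra k (FreeMonoid Z))) : Prop :=
  ∀ f ∈ G, ∀ g ∈ G, f ≠ 0 → g ≠ 0 →
    (∀ w u v : FreeMonoid Z, w = leadMon o f * u → w = v * leadMon o g →
      max (leadMon o f).length (leadMon o g).length < w.length →
      w.length < (leadMon o f).length + (leadMon o g).length →
      IsTrivialModAssoc o G w
        (monicize o f * MonoidAlgebra.of k _ u - MonoidAlgebra.of k _ v * monicize o g)) ∧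
    (∀ w u v : FreeMonoid Z, w = leadMon o f → w = u * leadMon o g * v →
      IsTrivialModAssoc o G w
        (monicize o f - MonoidAlgebra.of k _ u * monicize o g * MonoidAlgebra.of k _ v))

/-! ### Operated Gröbner–Shirshov bases -/

/-- A monomial order on `𝔐(Z)`: a well-order `≤` such that `u < v` implies `q|_u < q|_v` for all
`q ∈ 𝔐^⋆(Z)`. -/
def IsMonomialOrder {Z : Type*} (o : LinearOrder (OpWord Z)) : Prop :=
  WellFounded o.lt ∧ ∀ (u v : OpWord Z) (q : StarWord Z), o.lt u v → o.lt (q.fill u) (q.fill v)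

/-- The restriction to `𝓜(Z)` of a linear order on `𝔐(Z)`. -/
@[reducible] def restrictOrder {Z : Type*} (o : LinearOrder (OpWord Z)) : LinearOrder (FreeMonoid Z) :=
  letI := o
  LinearOrder.lift' (OpWord.ofFree Z) (OpWord.ofFree_injective Z)

/-- `f` is trivial modulo `(G, w)` in `k𝔐(Z)`: it is a linear combination of elements `q|_s`
with `s ∈ G`, `q ∈ 𝔐^⋆(Z)` and `q|_s̄ < w`. -/
def IsTrivialMod {k Z : Type*} [Field k] (o : LinearOrder (OpWord Z))
    (G : Set (FreeOpAlg k Z)) (w : OpWord Z) (f : FreeOpAlg k Z) : Prop :=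
  f ∈ Submodule.span k {h | ∃ s ∈ G, ∃ q : StarWord Z, o.lt (q.fill (leadMon o s)) w ∧
    h = q.fillLin s}

/-- `G` is an operated Gröbner–Shirshov basis in `k𝔐(Z)`: all intersection compositions and all
inclusion compositions of (monicized nonzero) elements of `G` are trivial. -/
def IsOperatedGSBasis {k Z : Type*} [Field k] (o : LinearOrder (OpWord Z))
    (G : Set (FreeOpAlg k Z)) : Prop :=
  ∀ f ∈ G, ∀ g ∈ G, f ≠ 0 → g ≠ 0 →
    (∀ w u v : OpWord Z, w = leadMon o f * u → w = v * leadMon o g →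
      max (leadMon o f).breadth (leadMon o g).breadth < w.breadth →
      w.breadth < (leadMon o f).breadth + (leadMon o g).breadth →
      IsTrivialMod o G w
        (monicize o f * MonoidAlgebra.of k _ u - MonoidAlgebra.of k _ v * monicize o g)) ∧
    (∀ (w : OpWord Z) (q : StarWord Z), w = leadMon o f → w = q.fill (leadMon o g) →
      IsTrivialMod o G w (monicize o f - q.fillLin (monicize o g)))

/-- `Irr(G)`: the words which are not of the form `q|_s̄` with `0 ≠ s ∈ G` and `q ∈ 𝔐^⋆(Z)`. -/
def Irr {k Z : Type*} [Field k] (o : LinearOrder (OpWord Z)) (G : Set (FreeOpAlg k Z)) :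
    Set (OpWord Z) :=
  {m | ¬ ∃ s ∈ G, s ≠ 0 ∧ ∃ q : StarWord Z, m = q.fill (leadMon o s)}

end

universe uk ux uz ub

/-! ### Combinatorics of operated words -/

namespace OpWord

section Words

variable {Z : Type*}

/-! The heart of the matter is that the union of `SPhi Φ Z` and the image of `G` is again an
operated GS basis. The composition–diamond lemma then gives the basis of irreducible words, and
freeness is a formal consequence of multilinearity.

Composition–diamond lemma. Two occurrences of leading monomials in one word are nested, overlap
properly, or are disjoint (`Ctx.position_or`). The first two cases are compositions placed in a
context; the third is trivial by expanding a product (`lin_sub_lin_mem_of_disjoint`). So the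
elements `C|_s` form a family in which two members with the same leading monomial differ by a
combination of members with smaller ones. The rest is linear algebra over a well-order
(`exists_basis_of_confluent`).

The union. Compositions inside `SPhi Φ Z` are trivial by assumption, and those inside `G` remain so
because a bracket-free word has only bracket-free subwords. For a mixed composition, no two
variables are adjacent in the leading monomial of `φ`, so a nonempty bracket-free word occurring in
its instance `φ̄(θ)` lies inside the value of one variable `x` (`NoAdjacent.exists_ctx`). If `θ x =
E|_ḡ`, then `φ` with its variable `x` set to `E|_g` lies in the ideal of `g`; by linearity in `x` it
is `φ(θ)` plus instances of `φ` with smaller leading monomials. This makes the inclusion composition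
trivial (`monicize_substOPI_sub_lin_mem`). An overlap `φ̄(θ) u = v ḡ` is turned into an inclusion by
absorbing `u` into the value of the last variable: the new instance of `φ` is compared once with
`φ(θ) u` and once with `v g`.

This needs the new instance to be nonzero, although an instance of an identity may well vanish.
`substOPI_eq_zero_of_rename` supplies it: if `φ` vanished after `u` was absorbed, it would still
vanish with the letters of `u` erased. To prove it, make all letter occurrences distinct and label
them so that the predicted leading word is least possible. A monomial cancelling against the leading
one after identification of letters is a permutation of it; minimality and maximality force the two
to agree.

If some nonzero element has leading monomial `1`, every composition is trivial for another reason.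
This disposes of the degenerate cases, in particular that of an identity led by a single variable.
-/

theorem letter_eq (z : Z) (w : OpWord Z) : letter z w = of z * w := rfl

theorem bracket_eq (u w : OpWord Z) : bracket u w = brk u * w := rfl

@[elab_as_elim]
theorem induction_mul {motive : OpWord Z → Prop} (w : OpWord Z) (one : motive 1)
    (of_mul : ∀ z w, motive w → motive (of z * w))
    (brk_mul : ∀ u w, motive u → motive w → motive (brk u * w)) : motive w := by
  induction w with
  | one => exact one
  | letter z w ih => exact of_mul z w ih
  | bracket u w ihu ihw => exact brk_mul u w ihu ihw

@[simp] theorem of_mul_inj {y z : Z} {v w : OpWord Z} :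
    of y * v = of z * w ↔ y = z ∧ v = w := by
  rw [← letter_eq, ← letter_eq, letter.injEq]

@[simp] theorem brk_mul_inj {y z v w : OpWord Z} :
    brk y * v = brk z * w ↔ y = z ∧ v = w := by
  rw [← bracket_eq, ← bracket_eq, bracket.injEq]

@[simp] theorem of_mul_ne_brk_mul {y : Z} {z v w : OpWord Z} : of y * v ≠ brk z * w :=
  fun h => nomatch h

@[simp] theorem brk_mul_ne_of_mul {y : Z} {z v w : OpWord Z} : brk z * w ≠ of y * v :=
  fun h => nomatch h

@[simp] theorem of_mul_ne_one {y : Z} {v : OpWord Z} : of y * v ≠ 1 :=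
  fun h => nomatch h

@[simp] theorem brk_mul_ne_one {y v : OpWord Z} : brk y * v ≠ 1 :=
  fun h => nomatch h

@[simp] theorem of_ne_one {y : Z} : of y ≠ 1 := fun h => nomatch h

@[simp] theorem brk_ne_one {y : OpWord Z} : brk y ≠ 1 := fun h => nomatch h

@[simp] theorem one_ne_of_mul {y : Z} {v : OpWord Z} : 1 ≠ of y * v :=
  fun h => nomatch h

@[simp] theorem one_ne_brk_mul {y v : OpWord Z} : 1 ≠ brk y * v :=
  fun h => nomatch h

theorem brk_injective : Function.Injective (brk : OpWord Z → OpWord Z) := by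
  intro a b h
  rw [← mul_one (brk a), ← mul_one (brk b)] at h
  exact (brk_mul_inj.1 h).1

@[simp] theorem breadth_one : breadth (1 : OpWord Z) = 0 := rfl

@[simp] theorem breadth_mul (u v : OpWord Z) : (u * v).breadth = u.breadth + v.breadth := by
  induction u using induction_mul with
  | one => simp
  | of_mul z w ih => rw [mul_assoc, ← letter_eq, ← letter_eq, breadth, breadth, ih]; omega
  | brk_mul z w _ ih => rw [mul_assoc, ← bracket_eq, ← bracket_eq, breadth, breadth, ih]; omega

@[simp] theorem breadth_of (z : Z) : (of z).breadth = 1 := rfl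

@[simp] theorem breadth_brk (u : OpWord Z) : (brk u).breadth = 1 := rfl

@[simp] theorem breadth_eq_zero {u : OpWord Z} : u.breadth = 0 ↔ u = 1 := by
  induction u using induction_mul <;> simp

theorem breadth_ne_zero {u : OpWord Z} : u.breadth ≠ 0 ↔ u ≠ 1 := breadth_eq_zero.not

@[simp] theorem mul_eq_one_iff' {u v : OpWord Z} : u * v = 1 ↔ u = 1 ∧ v = 1 := by
  rw [← breadth_eq_zero, breadth_mul, Nat.add_eq_zero_iff, breadth_eq_zero, breadth_eq_zero]

@[simp] theorem one_eq_mul_iff' {u v : OpWord Z} : 1 = u * v ↔ u = 1 ∧ v = 1 := by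
  rw [eq_comm, mul_eq_one_iff']

/-- Levi's lemma for operated words. -/
theorem levi {a b c d : OpWord Z} (h : a * b = c * d) :
    (∃ z, c = a * z ∧ b = z * d) ∨ ∃ z, a = c * z ∧ d = z * b := by
  induction a using induction_mul generalizing c with
  | one => exact Or.inl ⟨c, by simp, by simpa using h⟩
  | of_mul y w ih =>
    induction c using induction_mul with
    | one => exact Or.inr ⟨of y * w, by simp, by simpa using h.symm⟩
    | of_mul y' w' _ =>
      simp only [mul_assoc, of_mul_inj] at h ⊢
      obtain ⟨rfl, h⟩ := h
      simpa using ih h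
    | brk_mul y' w' _ _ => simp [mul_assoc] at h
  | brk_mul y w _ ih =>
    induction c using induction_mul with
    | one => exact Or.inr ⟨brk y * w, by simp, by simpa using h.symm⟩
    | of_mul y' w' _ => simp [mul_assoc] at h
    | brk_mul y' w' _ _ =>
      simp only [mul_assoc, brk_mul_inj] at h ⊢
      obtain ⟨rfl, h⟩ := h
      simpa using ih h

theorem mul_left_cancel' {a b c : OpWord Z} (h : a * b = a * c) : b = c := by
  obtain ⟨z, h1, h2⟩ | ⟨z, h1, h2⟩ := levi h <;>
  · have := congrArg breadth h1
    have hz : z = 1 := by simpa using this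
    simpa [hz, eq_comm] using h2

theorem mul_right_cancel' {a b c : OpWord Z} (h : b * a = c * a) : b = c := by
  obtain ⟨z, h1, h2⟩ | ⟨z, h1, h2⟩ := levi h <;>
  · have := congrArg breadth h2
    have hz : z = 1 := by simpa using this
    simpa [hz, eq_comm] using h1

/-- A word of breadth one has only trivial factorizations. -/
theorem mul_eq_brk {u v w : OpWord Z} (h : u * v = brk w) :
    (u = 1 ∧ v = brk w) ∨ (u = brk w ∧ v = 1) := by
  have := congrArg breadth h
  simp only [breadth_mul, breadth_brk] at this
  obtain h0 | h0 : u.breadth = 0 ∨ v.breadth = 0 := by omega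
  · rw [breadth_eq_zero] at h0
    subst h0
    exact Or.inl ⟨rfl, by simpa using h⟩
  · rw [breadth_eq_zero] at h0
    subst h0
    exact Or.inr ⟨by simpa using h, rfl⟩

/-- Words are built by adding factors on the left; this is the case distinction on the last factor,
needed for arguments about suffixes. -/
theorem eq_one_or_eq_mul (w : OpWord Z) :
    w = 1 ∨ (∃ v z, w = v * of z) ∨ ∃ v u, w = v * brk u := by
  induction w using induction_mul with
  | one => exact Or.inl rfl
  | of_mul z w ih =>
    obtain rfl | ⟨v, y, rfl⟩ | ⟨v, y, rfl⟩ := ih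
    · exact Or.inr (Or.inl ⟨1, z, by simp⟩)
    · exact Or.inr (Or.inl ⟨of z * v, y, by simp [mul_assoc]⟩)
    · exact Or.inr (Or.inr ⟨of z * v, y, by simp [mul_assoc]⟩)
  | brk_mul z w _ ih =>
    obtain rfl | ⟨v, y, rfl⟩ | ⟨v, y, rfl⟩ := ih
    · exact Or.inr (Or.inr ⟨1, z, by simp⟩)
    · exact Or.inr (Or.inl ⟨brk z * v, y, by simp [mul_assoc]⟩)
    · exact Or.inr (Or.inr ⟨brk z * v, y, by simp [mul_assoc]⟩)

/-- The relative position of two factors `a` and `b` of a word `u₁ a v₁ = u₂ b v₂`: `a` is to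
the left of `b`, or `a` is a factor of `b`, or they overlap properly. -/
def FactorPosition (u₁ a v₁ u₂ b v₂ : OpWord Z) : Prop :=
  (∃ z, u₂ = u₁ * a * z ∧ v₁ = z * b * v₂) ∨
  (∃ x y, b = x * a * y ∧ u₁ = u₂ * x ∧ v₁ = y * v₂) ∨
  ∃ x y z, x ≠ 1 ∧ y ≠ 1 ∧ z ≠ 1 ∧ a = x * y ∧ b = y * z ∧ u₂ = u₁ * x ∧ v₁ = z * v₂

theorem factorPosition_of_eq {u₁ a v₁ z b v₂ : OpWord Z} (h : a * v₁ = z * (b * v₂)) :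
    FactorPosition u₁ a v₁ (u₁ * z) b v₂ ∨ FactorPosition (u₁ * z) b v₂ u₁ a v₁ := by
  obtain ⟨z', rfl, rfl⟩ | ⟨z', rfl, h'⟩ := levi h
  · exact Or.inl (Or.inl ⟨z', by simp [mul_assoc], by simp [mul_assoc]⟩)
  obtain ⟨z'', rfl, rfl⟩ | ⟨z'', rfl, rfl⟩ := levi h'
  · exact Or.inr (Or.inr (Or.inl ⟨z, z'', by simp [mul_assoc], rfl, rfl⟩))
  -- Here `a = z z'` and `b = z' z''`. If one of the three pieces is empty, the configuration counts
  -- as nested or disjoint, so that a proper overlap has three nonempty pieces.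
  by_cases hz : z = 1
  · subst hz
    exact Or.inl (Or.inr (Or.inl ⟨1, z'', by simp, by simp, rfl⟩))
  by_cases hz' : z' = 1
  · subst hz'
    exact Or.inl (Or.inl ⟨1, by simp, by simp⟩)
  by_cases hz'' : z'' = 1
  · subst hz''
    exact Or.inr (Or.inr (Or.inl ⟨z, 1, by simp, rfl, by simp⟩))
  exact Or.inl (Or.inr (Or.inr ⟨z, z', z'', hz, hz', hz'', rfl, rfl, rfl, rfl⟩))

theorem factorPosition_or {u₁ a v₁ u₂ b v₂ : OpWord Z} (h : u₁ * a * v₁ = u₂ * b * v₂) :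
    FactorPosition u₁ a v₁ u₂ b v₂ ∨ FactorPosition u₂ b v₂ u₁ a v₁ := by
  rw [mul_assoc, mul_assoc] at h
  obtain ⟨z, rfl, h'⟩ | ⟨z, rfl, h'⟩ := levi h
  · exact factorPosition_of_eq h'
  · exact (factorPosition_of_eq h').symm

end Words

/-! ### Substitution -/

section Subst

variable {X Y Z : Type*}

@[simp] theorem lift_of {M : Type*} [Monoid M] (P : M → M) (θ : Z → M) (z : Z) :
    lift P θ (of z) = θ z :=
  mul_one _

@[simp] theorem lift_brk {M : Type*} [Monoid M] (P : M → M) (θ : Z → M) (u : OpWord Z) :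
    lift P θ (brk u) = P (lift P θ u) :=
  mul_one _

@[simp] theorem subst_of (θ : X → OpWord Z) (x : X) : subst θ (of x) = θ x := lift_of _ _ _

@[simp] theorem subst_brk (θ : X → OpWord Z) (u : OpWord X) :
    subst θ (brk u) = brk (subst θ u) := lift_brk _ _ _

theorem lift_subst {M : Type*} [Monoid M] (P : M → M) (θ : X → OpWord Y) (ρ : Y → M)
    (w : OpWord X) : lift P ρ (subst θ w) = lift P (fun x => lift P ρ (θ x)) w := by
  induction w using induction_mul with
  | one => simp
  | of_mul z w ih => simp [ih]
  | brk_mul u w ih1 ih2 => simp [ih1, ih2]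

theorem subst_subst (θ : X → OpWord Y) (ρ : Y → OpWord Z) (w : OpWord X) :
    subst ρ (subst θ w) = subst (fun x => subst ρ (θ x)) w := lift_subst _ _ _ _

@[simp] theorem subst_of_eq (w : OpWord Z) : subst of w = w := by
  induction w using induction_mul with
  | one => simp
  | of_mul z w ih => simp [ih]
  | brk_mul u w ih1 ih2 => simp [ih1, ih2]

@[simp] theorem count_one (z : Z) : count z 1 = 0 := rfl

open Classical in
theorem count_of (z y : Z) : count z (of y) = if y = z then 1 else 0 := by
  change (if y = z then 1 else 0) + 0 = _
  simp

@[simp] theorem count_of_self (z : Z) : count z (of z) = 1 := by simp [count_of]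

@[simp] theorem count_brk (z : Z) (u : OpWord Z) : count z (brk u) = count z u := by
  change count z u + 0 = _
  simp

@[simp] theorem count_mul (z : Z) (u v : OpWord Z) :
    count z (u * v) = count z u + count z v := by
  induction u using induction_mul with
  | one => simp
  | of_mul y w ih =>
    rw [mul_assoc, ← letter_eq, ← letter_eq, count, count, ih, add_assoc]
  | brk_mul y w _ ih =>
    rw [mul_assoc, ← bracket_eq, ← bracket_eq, count, count, ih, add_assoc]

theorem lift_congr {M : Type*} [Monoid M] (P : M → M) {θ ρ : X → M} {w : OpWord X}
    (h : ∀ x, count x w ≠ 0 → θ x = ρ x) : lift P θ w = lift P ρ w := by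
  induction w using induction_mul with
  | one => simp
  | of_mul z w ih =>
    rw [map_mul, map_mul, lift_of, lift_of, h z (by simp), ih fun x hx => h x (by simp [hx])]
  | brk_mul u w ih1 ih2 =>
    rw [map_mul, map_mul, lift_brk, lift_brk, ih1 fun x hx => h x (by simp [hx]),
      ih2 fun x hx => h x (by simp [hx])]

theorem lift_update_of_count_eq_zero {M : Type*} [Monoid M] [DecidableEq X] (P : M → M)
    (θ : X → M) {x : X} {w : OpWord X} (h : count x w = 0) (t : M) :
    lift P (Function.update θ x t) w = lift P θ w :=
  lift_congr P fun y hy => Function.update_of_ne (by rintro rfl; exact hy h) _ _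

theorem subst_update_of_count_eq_zero [DecidableEq X] (θ : X → OpWord Z) {x : X} {w : OpWord X}
    (h : count x w = 0) (t : OpWord Z) : subst (Function.update θ x t) w = subst θ w :=
  lift_update_of_count_eq_zero _ _ h _

end Subst

/-! ### Bracket-free words -/

section Flat

variable {Z : Type*}

/-- The word contains no brackets. -/
def IsFlat (w : OpWord Z) : Prop := ∃ c : FreeMonoid Z, ofFree Z c = w

@[simp] theorem ofFree_of (z : Z) : ofFree Z (FreeMonoid.of z) = of z := FreeMonoid.lift_eval_of _ _

@[simp] theorem isFlat_ofFree (c : FreeMonoid Z) : IsFlat (ofFree Z c) := ⟨c, rfl⟩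

@[simp] theorem breadth_ofFree (c : FreeMonoid Z) : (ofFree Z c).breadth = c.length := by
  induction c using FreeMonoid.inductionOn' with
  | one => simp
  | of_mul z c ih => simp [ih]

theorem isFlat_one : IsFlat (1 : OpWord Z) := ⟨1, map_one _⟩

theorem isFlat_of_mul {z : Z} {w : OpWord Z} : IsFlat (of z * w) ↔ IsFlat w := by
  constructor
  · rintro ⟨c, hc⟩
    induction c using FreeMonoid.inductionOn' with
    | one => simp at hc
    | of_mul y c _ =>
      rw [map_mul, ofFree_of, of_mul_inj] at hc
      exact ⟨c, hc.2⟩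
  · rintro ⟨c, rfl⟩
    exact ⟨FreeMonoid.of z * c, by simp⟩

theorem not_isFlat_brk_mul {u w : OpWord Z} : ¬ IsFlat (brk u * w) := by
  rintro ⟨c, hc⟩
  induction c using FreeMonoid.inductionOn' with
  | one => simp at hc
  | of_mul y c _ =>
    rw [map_mul, ofFree_of] at hc
    simp at hc

theorem isFlat_mul {u v : OpWord Z} : IsFlat (u * v) ↔ IsFlat u ∧ IsFlat v := by
  induction u using induction_mul with
  | one => simp [isFlat_one]
  | of_mul z w ih => rw [mul_assoc, isFlat_of_mul, isFlat_of_mul, ih]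
  | brk_mul u w _ _ => simp [mul_assoc, not_isFlat_brk_mul]

theorem not_isFlat_brk {u : OpWord Z} : ¬ IsFlat (brk u) := by
  rw [← mul_one (brk u)]
  exact not_isFlat_brk_mul

end Flat

end OpWord

/-! ### Contexts -/

/-- A word with a hole: `flat u v` stands for `u ⋆ v` and `nest u C v` for `u ⌊C⌋ v`. -/
inductive Ctx (Z : Type*) where
  | flat (u v : OpWord Z) : Ctx Z
  | nest (u : OpWord Z) (C : Ctx Z) (v : OpWord Z) : Ctx Z

namespace Ctx

open OpWord

section Fill

variable {X Z : Type*}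

/-- The hole of a context is replaced by a word. -/
def fill : Ctx Z → OpWord Z → OpWord Z
  | flat u v, t => u * t * v
  | nest u C v, t => u * brk (C.fill t) * v

/-- Composition of contexts. -/
def comp : Ctx Z → Ctx Z → Ctx Z
  | flat u v, flat u' v' => flat (u * u') (v' * v)
  | flat u v, nest u' D v' => nest (u * u') D (v' * v)
  | nest u C v, D => nest u (C.comp D) v

@[simp] theorem fill_flat (u v t : OpWord Z) : (flat u v).fill t = u * t * v := rfl

@[simp] theorem fill_nest (u v t : OpWord Z) (C : Ctx Z) :
    (nest u C v).fill t = u * brk (C.fill t) * v := rfl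

@[simp] theorem fill_comp (C D : Ctx Z) (t : OpWord Z) :
    (C.comp D).fill t = C.fill (D.fill t) := by
  induction C with
  | flat u v => cases D <;> simp [comp, mul_assoc]
  | nest u C v ih => simp [comp, ih]

/-- Substitution in a context. -/
def subst (θ : X → OpWord Z) : Ctx X → Ctx Z
  | flat u v => flat (OpWord.subst θ u) (OpWord.subst θ v)
  | nest u C v => nest (OpWord.subst θ u) (C.subst θ) (OpWord.subst θ v)

theorem exists_fill_of_count_ne_zero {x : X} {m : OpWord X} (h : m.count x ≠ 0) :
    ∃ F : Ctx X, m = F.fill (of x) := by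
  induction m using induction_mul with
  | one => simp at h
  | of_mul z w ih =>
    by_cases hz : z = x
    · exact ⟨flat 1 w, by simp [hz]⟩
    · obtain ⟨F, rfl⟩ := ih (by simpa [count_of, hz] using h)
      exact ⟨(flat (of z) 1).comp F, by simp⟩
  | brk_mul u w ih1 ih2 =>
    by_cases hu : u.count x = 0
    · obtain ⟨F, rfl⟩ := ih2 (by simpa [hu] using h)
      exact ⟨(flat (brk u) 1).comp F, by simp⟩
    · obtain ⟨F, rfl⟩ := ih1 hu
      exact ⟨nest 1 F w, by simp⟩

/-- The only occurrence of `x` is the hole itself, so changing the value of `x` does not affect the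
context around it. -/
theorem subst_update_fill [DecidableEq X] (θ : X → OpWord Z) {x : X} {F : Ctx X}
    (h : (F.fill (of x)).count x = 1) (t : OpWord Z) :
    OpWord.subst (Function.update θ x t) (F.fill (of x)) = (F.subst θ).fill t := by
  induction F with
  | flat u v =>
    simp only [fill_flat, count_mul, count_of_self] at h
    simp [Ctx.subst, subst_update_of_count_eq_zero θ (show count x u = 0 by omega),
      subst_update_of_count_eq_zero θ (show count x v = 0 by omega)]
  | nest u F v ih =>
    -- The hole already accounts for one occurrence, so `u` and `v` contain none.
    have h1 : 1 ≤ (F.fill (of x)).count x := by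
      clear ih h
      induction F with
      | flat u v => simp; omega
      | nest u F v ih => simp; omega
    simp only [fill_nest, count_mul, count_brk] at h
    simp [Ctx.subst, subst_update_of_count_eq_zero θ (show count x u = 0 by omega),
      subst_update_of_count_eq_zero θ (show count x v = 0 by omega), ih (by omega)]

theorem exists_subst_update_eq [DecidableEq X] (θ : X → OpWord Z) {x : X} {m : OpWord X}
    (h : m.count x = 1) :
    ∃ D : Ctx Z, ∀ t, OpWord.subst (Function.update θ x t) m = D.fill t := by
  obtain ⟨F, rfl⟩ := exists_fill_of_count_ne_zero (show m.count x ≠ 0 by omega)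
  exact ⟨F.subst θ, subst_update_fill θ h⟩

end Fill

/-! ### Contexts and words with a star define the same maps. -/

section Star

variable {Z : Type*}

/-- With its converse below, this allows replacing star words by contexts, on which one can argue by
induction on the depth of the hole. -/
theorem exists_fill_eq_starWord_fill (q : StarWord Z) : ∃ C : Ctx Z, q.fill = C.fill := by
  classical
  obtain ⟨D, hD⟩ := exists_subst_update_eq (fun o : Option Z => o.elim 1 of) q.2
  refine ⟨D, funext fun t => ?_⟩
  rw [← hD, StarWord.fill]
  congr 2
  ext o
  cases o <;> simp

theorem exists_starWord_fill_eq (C : Ctx Z) : ∃ q : StarWord Z, q.fill = C.fill := by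
  have hc : ∀ u : OpWord Z, count none (OpWord.subst (fun z => of (some z)) u) = 0 := by
    intro u
    induction u using induction_mul with
    | one => simp
    | of_mul z w ih => simp [ih, count_of]
    | brk_mul u w ih1 ih2 => simp [ih1, ih2]
  have hs : ∀ u t : OpWord Z, OpWord.subst (fun o : Option Z => o.elim t of)
      (OpWord.subst (fun z => of (some z)) u) = u := by
    intro u t
    rw [subst_subst]
    simp only [subst_of, Option.elim]
    exact subst_of_eq u
  suffices h : ∃ w : OpWord (Option Z), w.count none = 1 ∧
      ∀ t, OpWord.subst (fun o : Option Z => o.elim t of) w = C.fill t by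
    obtain ⟨w, h1, h2⟩ := h
    exact ⟨⟨w, h1⟩, funext h2⟩
  induction C with
  | flat u v =>
    refine ⟨OpWord.subst (fun z => of (some z)) u * of none *
      OpWord.subst (fun z => of (some z)) v, by simp [hc], fun t => ?_⟩
    simp [hs]
  | nest u C v ih =>
    obtain ⟨w, h1, h2⟩ := ih
    refine ⟨OpWord.subst (fun z => of (some z)) u * brk w *
      OpWord.subst (fun z => of (some z)) v, by simp [hc, h1], fun t => ?_⟩
    simp [hs, h2]

end Star

/-! ### Two occurrences of words in a word -/

section Position

variable {Z : Type*}

/-- The relative position of two occurrences `C₁|_a = C₂|_b` of words `a` and `b`: `a` is nested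
in `b`, or `a` properly overlaps `b` from the left, or `a` and `b` are disjoint and `a` is to the
left of `b`. -/
def Position (C₁ : Ctx Z) (a : OpWord Z) (C₂ : Ctx Z) (b : OpWord Z) : Prop :=
  (∃ D : Ctx Z, b = D.fill a ∧ ∀ t, C₁.fill t = C₂.fill (D.fill t)) ∨
  (∃ (E : Ctx Z) (x y z : OpWord Z), x ≠ 1 ∧ y ≠ 1 ∧ z ≠ 1 ∧ a = x * y ∧ b = y * z ∧
    (∀ t, C₁.fill t = E.fill (t * z)) ∧ ∀ t, C₂.fill t = E.fill (x * t)) ∨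
  ∃ E D₁ D₂ : Ctx Z, (∀ t, C₁.fill t = E.fill (D₁.fill t * D₂.fill b)) ∧
    ∀ t, C₂.fill t = E.fill (D₁.fill a * D₂.fill t)

theorem Position.nest {C₁ C₂ : Ctx Z} {a b : OpWord Z} (h : Position C₁ a C₂ b)
    (u v : OpWord Z) : Position (nest u C₁ v) a (nest u C₂ v) b := by
  obtain ⟨D, h1, h2⟩ | ⟨E, x, y, z, hx, hy, hz, ha, hb, h1, h2⟩ | ⟨E, D₁, D₂, h1, h2⟩ := h
  · exact Or.inl ⟨D, h1, fun t => by simp [h2]⟩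
  · exact Or.inr (Or.inl ⟨Ctx.nest u E v, x, y, z, hx, hy, hz, ha, hb, fun t => by simp [h1],
      fun t => by simp [h2]⟩)
  · exact Or.inr (Or.inr ⟨Ctx.nest u E v, D₁, D₂, fun t => by simp [h1], fun t => by simp [h2]⟩)

theorem position_flat {u₁ a v₁ u₂ b v₂ : OpWord Z} (h : FactorPosition u₁ a v₁ u₂ b v₂) :
    Position (flat u₁ v₁) a (flat u₂ v₂) b := by
  obtain ⟨z, rfl, rfl⟩ | ⟨x, y, rfl, rfl, rfl⟩ | ⟨x, y, z, hx, hy, hz, rfl, rfl, rfl, rfl⟩ := h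
  · exact Or.inr (Or.inr ⟨flat u₁ v₂, flat 1 z, flat 1 1, fun t => by simp [mul_assoc],
      fun t => by simp [mul_assoc]⟩)
  · exact Or.inl ⟨flat x y, by simp, fun t => by simp [mul_assoc]⟩
  · exact Or.inr (Or.inl ⟨flat u₁ v₂, x, y, z, hx, hy, hz, rfl, rfl,
      fun t => by simp [mul_assoc], fun t => by simp [mul_assoc]⟩)

/-- A bracket has breadth one, so nothing overlaps it properly. A factor of it is empty, and then
counts as disjoint, or is the whole bracket, and then `b` is nested in `a`. -/
theorem position_flat_nest {u₁ a v₁ u₂ b v₂ : OpWord Z} {C : Ctx Z}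
    (h : FactorPosition u₁ a v₁ u₂ (brk (C.fill b)) v₂) :
    Position (flat u₁ v₁) a (nest u₂ C v₂) b ∨ Position (nest u₂ C v₂) b (flat u₁ v₁) a := by
  obtain ⟨z, rfl, rfl⟩ | ⟨x, y, h, rfl, rfl⟩ | ⟨x, y, z, hx, hy, hz, rfl, h, rfl, rfl⟩ := h
  · exact Or.inl (Or.inr (Or.inr ⟨flat u₁ v₂, flat 1 z, nest 1 C 1, fun t => by simp [mul_assoc],
      fun t => by simp [mul_assoc]⟩))
  · obtain ⟨h', rfl⟩ | ⟨h', rfl⟩ := mul_eq_brk h.symm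
    · rw [mul_eq_one_iff'] at h'
      obtain ⟨rfl, rfl⟩ := h'
      exact Or.inl (Or.inr (Or.inr ⟨flat u₂ v₂, flat 1 1, nest 1 C 1,
        fun t => by simp [mul_assoc], fun t => by simp [mul_assoc]⟩))
    · obtain ⟨rfl, rfl⟩ | ⟨rfl, rfl⟩ := mul_eq_brk h'
      · exact Or.inr (Or.inl ⟨nest 1 C 1, by simp, fun t => by simp⟩)
      · exact Or.inr (Or.inr (Or.inr ⟨flat u₂ v₂, nest 1 C 1, flat 1 1,
          fun t => by simp [mul_assoc], fun t => by simp [mul_assoc]⟩))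
  · obtain ⟨rfl, rfl⟩ | ⟨rfl, rfl⟩ := mul_eq_brk h.symm <;> contradiction

theorem position_nest_flat {u₁ a v₁ u₂ b v₂ : OpWord Z} {C : Ctx Z}
    (h : FactorPosition u₂ (brk (C.fill b)) v₂ u₁ a v₁) :
    Position (nest u₂ C v₂) b (flat u₁ v₁) a := by
  obtain ⟨z, rfl, rfl⟩ | ⟨x, y, rfl, rfl, rfl⟩ | ⟨x, y, z, hx, hy, hz, h, rfl, rfl, rfl⟩ := h
  · exact Or.inr (Or.inr ⟨flat u₂ v₁, nest 1 C z, flat 1 1, fun t => by simp [mul_assoc],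
      fun t => by simp [mul_assoc]⟩)
  · exact Or.inl ⟨nest x C y, by simp, fun t => by simp [mul_assoc]⟩
  · obtain ⟨rfl, rfl⟩ | ⟨rfl, rfl⟩ := mul_eq_brk h.symm <;> contradiction

theorem position_nest_nest {u₁ a v₁ u₂ b v₂ : OpWord Z} {C D : Ctx Z}
    (h : FactorPosition u₁ (brk (C.fill a)) v₁ u₂ (brk (D.fill b)) v₂) :
    Position (nest u₁ C v₁) a (nest u₂ D v₂) b ∨ C.fill a = D.fill b ∧ u₁ = u₂ ∧ v₁ = v₂ := by
  obtain ⟨z, rfl, rfl⟩ | ⟨x, y, h, rfl, rfl⟩ | ⟨x, y, z, hx, hy, hz, h, -, rfl, rfl⟩ := h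
  · exact Or.inl (Or.inr (Or.inr ⟨flat u₁ v₂, nest 1 C z, nest 1 D 1,
      fun t => by simp [mul_assoc], fun t => by simp [mul_assoc]⟩))
  · have hb := congrArg breadth h
    simp only [breadth_brk, breadth_mul] at hb
    obtain rfl : x = 1 := breadth_eq_zero.1 (by omega)
    obtain rfl : y = 1 := breadth_eq_zero.1 (by omega)
    simp only [one_mul, mul_one] at h
    exact Or.inr ⟨(brk_injective h).symm, by simp, by simp⟩
  · obtain ⟨rfl, rfl⟩ | ⟨rfl, rfl⟩ := mul_eq_brk h.symm <;> contradiction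

/-- Compare the outermost factors containing the two holes. Only when both holes lie in the same
bracket is nothing decided, and then one descends into it. -/
theorem position_or {C₁ C₂ : Ctx Z} {a b : OpWord Z} (h : C₁.fill a = C₂.fill b) :
    Position C₁ a C₂ b ∨ Position C₂ b C₁ a := by
  induction C₁ generalizing C₂ with
  | flat u₁ v₁ =>
    cases C₂ with
    | flat u₂ v₂ => exact (factorPosition_or h).imp position_flat position_flat
    | nest u₂ C v₂ =>
      obtain h | h := factorPosition_or h
      · exact position_flat_nest h
      · exact Or.inr (position_nest_flat h)
  | nest u₁ C v₁ ih =>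
    cases C₂ with
    | flat u₂ v₂ =>
      obtain h | h := factorPosition_or h
      · exact Or.inl (position_nest_flat h)
      · exact (position_flat_nest h).symm
    | nest u₂ D v₂ =>
      obtain h | h := factorPosition_or h
      · obtain h' | ⟨h', rfl, rfl⟩ := position_nest_nest h
        · exact Or.inl h'
        · exact (ih h').imp (Position.nest · _ _) (Position.nest · _ _)
      · obtain h' | ⟨h', rfl, rfl⟩ := position_nest_nest h
        · exact Or.inr h'
        · exact (ih h'.symm).imp (Position.nest · _ _) (Position.nest · _ _)

end Position

end Ctx

noncomputable section

/-! ### Families of polynomials with prescribed leading monomials -/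

namespace MonoidAlgebra

section LeadsWith

variable {k M ι : Type*} [Field k]

theorem map_mem_of_forall_single_mem {V : Type*} [AddCommGroup V] [Module k V]
    (L : MonoidAlgebra k M →ₗ[k] V) (p : Submodule k V) {f : MonoidAlgebra k M}
    (h : ∀ m, f.coeff m ≠ 0 → L (single m 1) ∈ p) : L f ∈ p := by
  rw [← sum_coeff_single f, Finsupp.sum, map_sum]
  refine p.sum_mem fun m hm => ?_
  have : (single m (f.coeff m) : MonoidAlgebra k M) = f.coeff m • single m 1 := by simp
  rw [this, map_smul]
  exact p.smul_mem _ (h m (Finsupp.mem_support_iff.1 hm))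

variable [LinearOrder M]

/-- `f` is monic with leading monomial `m`. -/
def LeadsWith (f : MonoidAlgebra k M) (m : M) : Prop :=
  f.coeff m = 1 ∧ ∀ m', f.coeff m' ≠ 0 → m' ≤ m

theorem LeadsWith.sub_single {f : MonoidAlgebra k M} {m : M} (h : f.LeadsWith m) (m' : M)
    (hm : (f - single m 1).coeff m' ≠ 0) : m' < m := by
  classical
  rw [coeff_sub, coeff_single, Finsupp.sub_apply, Finsupp.single_apply] at hm
  obtain rfl | hne := eq_or_ne m m'
  · simp [h.1] at hm
  · rw [if_neg hne, sub_zero] at hm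
    exact lt_of_le_of_ne (h.2 _ hm) hne.symm

variable {e : ι → MonoidAlgebra k M} {l : ι → M}

theorem coeff_eq_zero_of_mem_span (he : ∀ i, (e i).LeadsWith (l i)) {w : M}
    {f : MonoidAlgebra k M} (hf : f ∈ Submodule.span k (e '' {i | l i < w})) :
    f.coeff w = 0 := by
  induction hf using Submodule.span_induction with
  | mem x hx =>
    obtain ⟨i, hi, rfl⟩ := hx
    by_contra h
    exact absurd ((he i).2 w h) (not_le.2 hi)
  | zero => simp
  | add x y _ _ hx hy => simp [hx, hy]
  | smul c x _ hx => simp [hx]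

/-- Modulo members with smaller leading monomials, confluence replaces all members led by `w` by a
single one. Its total coefficient is then the coefficient of `f` at `w`, which is zero. -/
theorem mem_span_lt_of_coeff_eq_zero (he : ∀ i, (e i).LeadsWith (l i))
    (hc : ∀ i j, l i = l j → e i - e j ∈ Submodule.span k (e '' {m | l m < l i}))
    {w : M} {f : MonoidAlgebra k M} (hf : f ∈ Submodule.span k (e '' {i | l i ≤ w}))
    (h0 : f.coeff w = 0) : f ∈ Submodule.span k (e '' {i | l i < w}) := by
  by_cases hw : ∃ i, l i = w
  · obtain ⟨j, rfl⟩ := hw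
    obtain ⟨c, hcf⟩ : ∃ c : k, f - c • e j ∈ Submodule.span k (e '' {i | l i < l j}) := by
      clear h0
      induction hf using Submodule.span_induction with
      | mem x hx =>
        obtain ⟨i, hi, rfl⟩ := hx
        obtain hlt | heq := lt_or_eq_of_le (show l i ≤ l j from hi)
        · exact ⟨0, by simpa using Submodule.subset_span (Set.mem_image_of_mem e hlt)⟩
        · exact ⟨1, by simpa [heq] using hc i j heq⟩
      | zero => exact ⟨0, by simp⟩
      | add x y _ _ hx hy =>
        obtain ⟨c, hc⟩ := hx
        obtain ⟨d, hd⟩ := hy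
        refine ⟨c + d, ?_⟩
        rw [add_smul, add_sub_add_comm]
        exact add_mem hc hd
      | smul a x _ hx =>
        obtain ⟨c, hc⟩ := hx
        refine ⟨a * c, ?_⟩
        rw [mul_smul, ← smul_sub]
        exact Submodule.smul_mem _ a hc
    have h := coeff_eq_zero_of_mem_span he hcf
    rw [coeff_sub, Finsupp.sub_apply, h0, coeff_smul, Finsupp.smul_apply, (he j).1] at h
    obtain rfl : c = 0 := by simpa using h
    simpa using hcf
  · refine Submodule.span_mono (Set.image_mono fun i hi => ?_) hf
    exact lt_of_le_of_ne hi fun h => hw ⟨i, h⟩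

theorem eq_zero_or_mem_span_le {P : M → Prop} {f : MonoidAlgebra k M}
    (hf : f ∈ Submodule.span k (e '' {i | P (l i)})) :
    f = 0 ∨ ∃ w, P w ∧ f ∈ Submodule.span k (e '' {i | l i ≤ w}) := by
  induction hf using Submodule.span_induction with
  | mem x hx =>
    obtain ⟨i, hi, rfl⟩ := hx
    exact Or.inr ⟨l i, hi, Submodule.subset_span ⟨i, le_refl (l i), rfl⟩⟩
  | zero => exact Or.inl rfl
  | add x y _ _ hx hy =>
    obtain rfl | ⟨v, hv, hx⟩ := hx
    · simpa using hy
    obtain rfl | ⟨w, hw, hy⟩ := hy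
    · exact Or.inr ⟨v, hv, by simpa using hx⟩
    have mono : ∀ {a b : M}, a ≤ b → Submodule.span k (e '' {i | l i ≤ a}) ≤
        Submodule.span k (e '' {i | l i ≤ b}) := fun hab =>
      Submodule.span_mono (Set.image_mono fun i hi => le_trans hi hab)
    obtain hvw | hvw := le_total v w
    · exact Or.inr ⟨w, hw, add_mem (mono hvw hx) hy⟩
    · exact Or.inr ⟨v, hv, add_mem hx (mono hvw hy)⟩
  | smul c x _ hx =>
    obtain rfl | ⟨v, hv, hx⟩ := hx
    · simp
    · exact Or.inr ⟨v, hv, Submodule.smul_mem _ c hx⟩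

variable [WellFoundedLT M]

/-- An element of the span of a confluent family is a combination of members whose leading
monomials are at most its own leading monomial. -/
theorem eq_zero_or_mem_span_le_of_mem_span (he : ∀ i, (e i).LeadsWith (l i))
    (hc : ∀ i j, l i = l j → e i - e j ∈ Submodule.span k (e '' {m | l m < l i}))
    {f : MonoidAlgebra k M} (hf : f ∈ Submodule.span k (Set.range e)) :
    f = 0 ∨ ∃ w, f.coeff w ≠ 0 ∧ f ∈ Submodule.span k (e '' {i | l i ≤ w}) := by
  -- As long as `f` has no term at the bound `w`, the bound can be lowered; well-foundedness stops
  -- this.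
  have key : ∀ w, f ∈ Submodule.span k (e '' {i | l i ≤ w}) →
      f = 0 ∨ ∃ w, f.coeff w ≠ 0 ∧ f ∈ Submodule.span k (e '' {i | l i ≤ w}) := by
    intro w
    induction w using WellFoundedLT.induction with
    | ind w ih =>
      intro hw
      by_cases h0 : f.coeff w = 0
      · obtain h | ⟨v, hv, h⟩ :=
          eq_zero_or_mem_span_le (P := (· < w)) (mem_span_lt_of_coeff_eq_zero he hc hw h0)
        · exact Or.inl h
        · exact ih v hv h
      · exact Or.inr ⟨w, h0, hw⟩
  rw [← Set.image_univ] at hf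
  obtain h | ⟨w, -, h⟩ := eq_zero_or_mem_span_le (P := fun _ => True) (l := l) hf
  · exact Or.inl h
  · exact key w h

theorem mem_span_lt_of_mem_span (he : ∀ i, (e i).LeadsWith (l i))
    (hc : ∀ i j, l i = l j → e i - e j ∈ Submodule.span k (e '' {m | l m < l i}))
    {f : MonoidAlgebra k M} (hf : f ∈ Submodule.span k (Set.range e)) {w : M}
    (hw : ∀ m, f.coeff m ≠ 0 → m < w) : f ∈ Submodule.span k (e '' {i | l i < w}) := by
  obtain rfl | ⟨v, hv, h⟩ := eq_zero_or_mem_span_le_of_mem_span he hc hf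
  · exact zero_mem _
  · exact Submodule.span_mono (Set.image_mono fun i hi => lt_of_le_of_lt hi (hw v hv)) h

/-- The monomials which are not leading monomials of a confluent family form a basis of the
quotient by the span of the family. -/
theorem exists_basis_of_confluent (he : ∀ i, (e i).LeadsWith (l i))
    (hc : ∀ i j, l i = l j → e i - e j ∈ Submodule.span k (e '' {m | l m < l i}))
    {V : Type*} [AddCommGroup V] [Module k V] (π : MonoidAlgebra k M →ₗ[k] V)
    (hπ : Function.Surjective π) (hker : LinearMap.ker π = Submodule.span k (Set.range e))
    (I : Set M) (hI : ∀ m, m ∈ I ↔ m ∉ Set.range l) :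
    ∃ b : Module.Basis I k V, ∀ m, b m = π (single m.1 1) := by
  -- A relation is an element of the span supported on `I`. Being a combination of members led by at
  -- most some `w` in its support, none of which is led by `w ∈ I`, it has coefficient zero at `w`.
  have hli : LinearIndependent k fun m : I => π (single m.1 1) := by
    rw [linearIndependent_iff]
    intro c hcz
    have hf : Finsupp.linearCombination k (fun m : I => π (single m.1 1)) c =
        π (ofCoeff (c.mapDomain Subtype.val)) := by
      rw [Finsupp.linearCombination_apply, Finsupp.mapDomain, ofCoeff_finsuppSum,
        map_finsuppSum]
      refine Finsupp.sum_congr fun m _ => ?_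
      rw [← map_smul, ofCoeff_single, smul_single, smul_eq_mul, mul_one]
    rw [hf, ← LinearMap.mem_ker, hker] at hcz
    obtain h | ⟨w, hw, h⟩ := eq_zero_or_mem_span_le_of_mem_span he hc hcz
    · rw [ofCoeff_eq_zero] at h
      exact Finsupp.mapDomain_injective Subtype.val_injective (h.trans Finsupp.mapDomain_zero.symm)
    · exfalso
      have hwI : w ∈ I := by
        by_contra hwI
        exact hw (Finsupp.mapDomain_of_notMem_range _ _ (by simpa using hwI))
      refine hw (coeff_eq_zero_of_mem_span he (Submodule.span_mono (Set.image_mono ?_) h))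
      exact fun i hi => lt_of_le_of_ne hi fun h => (hI w).1 hwI ⟨i, h⟩
  -- Reduction: a leading monomial is congruent to minus the lower terms of the member it leads.
  have hmem : ∀ m, π (single m 1) ∈
      Submodule.span k (Set.range fun m : I => π (single m.1 1)) := by
    intro m
    induction m using WellFoundedLT.induction with
    | ind m ih =>
      by_cases hm : m ∈ I
      · exact Submodule.subset_span ⟨⟨m, hm⟩, rfl⟩
      · obtain ⟨i, rfl⟩ : m ∈ Set.range l := by
          by_contra h
          exact hm ((hI m).2 h)
        have h0 : π (e i) = 0 := by
          rw [← LinearMap.mem_ker, hker]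
          exact Submodule.subset_span ⟨i, rfl⟩
        have h1 := map_mem_of_forall_single_mem π _
          (fun m hm => ih m ((he i).sub_single m hm))
        rw [map_sub, h0, zero_sub] at h1
        exact (Submodule.neg_mem_iff _).1 h1
  refine ⟨Module.Basis.mk hli ?_, fun m => Module.Basis.mk_apply _ _ _⟩
  rintro v -
  obtain ⟨f, rfl⟩ := hπ v
  exact map_mem_of_forall_single_mem π _ fun m _ => hmem m

end LeadsWith

end MonoidAlgebra

open MonoidAlgebra OpWord

/-! ### Leading monomials -/

section LeadMon

variable {k M : Type*} [Field k] [Monoid M] [o : LinearOrder M]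

theorem leadMon_mem_support {f : MonoidAlgebra k M} (hf : f ≠ 0) : f.coeff (leadMon o f) ≠ 0 := by
  have h : f.coeff.support.Nonempty := by simpa [Finsupp.support_nonempty_iff] using hf
  rw [leadMon, dif_pos h]
  exact Finsupp.mem_support_iff.1 (Finset.max'_mem _ h)

theorem le_leadMon {f : MonoidAlgebra k M} {m : M} (hm : f.coeff m ≠ 0) : m ≤ leadMon o f := by
  have h : f.coeff.support.Nonempty := ⟨m, Finsupp.mem_support_iff.2 hm⟩
  rw [leadMon, dif_pos h]
  exact Finset.le_max' _ _ (Finsupp.mem_support_iff.2 hm)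

theorem leadMon_eq {f : MonoidAlgebra k M} {m : M} (h0 : f.coeff m ≠ 0)
    (h : ∀ m', f.coeff m' ≠ 0 → m' ≤ m) : leadMon o f = m := by
  have hf : f ≠ 0 := by
    rintro rfl
    simp at h0
  exact le_antisymm (h _ (leadMon_mem_support hf)) (le_leadMon h0)

theorem leadCoeff_ne_zero {f : MonoidAlgebra k M} (hf : f ≠ 0) : leadCoeff o f ≠ 0 :=
  leadMon_mem_support hf

theorem monicize_leadsWith {f : MonoidAlgebra k M} (hf : f ≠ 0) :
    (monicize o f).LeadsWith (leadMon o f) := by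
  constructor
  · rw [monicize, coeff_smul, Finsupp.smul_apply, smul_eq_mul]
    exact inv_mul_cancel₀ (leadCoeff_ne_zero hf)
  · intro m hm
    refine le_leadMon fun h => hm ?_
    rw [monicize, coeff_smul, Finsupp.smul_apply, h, smul_zero]

theorem leadCoeff_smul_monicize {f : MonoidAlgebra k M} (hf : f ≠ 0) :
    leadCoeff o f • monicize o f = f :=
  smul_inv_smul₀ (leadCoeff_ne_zero hf) f

end LeadMon

/-! ### Linear contexts -/

namespace Ctx

variable {k Z : Type*} [Field k]

/-- `C|_f` for an element `f` of `k𝔐(Z)`. -/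
def lin (C : Ctx Z) : FreeOpAlg k Z →ₗ[k] FreeOpAlg k Z := mapDomainLinearMap k k C.fill

@[simp] theorem lin_single (C : Ctx Z) (m : OpWord Z) (c : k) :
    C.lin (single m c) = single (C.fill m) c := mapDomainLinearMap_single _ _ _

theorem lin_congr {C D : Ctx Z} (h : ∀ t, C.fill t = D.fill t) :
    C.lin (k := k) = D.lin := by
  rw [lin, lin, funext h]

theorem lin_comp (C D : Ctx Z) (f : FreeOpAlg k Z) : (C.comp D).lin f = C.lin (D.lin f) := by
  induction f using MonoidAlgebra.induction_linear with
  | zero => simp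
  | add f g hf hg => simp only [map_add, hf, hg]
  | single m c => simp

theorem lin_flat (u v : OpWord Z) (f : FreeOpAlg k Z) :
    (flat u v).lin f = of k _ u * f * of k _ v := by
  induction f using MonoidAlgebra.induction_linear with
  | zero => simp
  | add f g hf hg => simp only [map_add, hf, hg, mul_add, add_mul]
  | single m c => simp [single_mul_single]

theorem lin_nest (u v : OpWord Z) (C : Ctx Z) (f : FreeOpAlg k Z) :
    (nest u C v).lin f = of k _ u * FreeOpAlg.op k Z (C.lin f) * of k _ v := by
  induction f using MonoidAlgebra.induction_linear with
  | zero => simp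
  | add f g hf hg => simp only [map_add, hf, hg, mul_add, add_mul]
  | single m c => simp [FreeOpAlg.op, single_mul_single]

theorem fillLin_eq_lin {q : StarWord Z} {C : Ctx Z} (h : q.fill = C.fill) :
    q.fillLin (k := k) = C.lin := by
  rw [lin, StarWord.fillLin, h]

variable [o : LinearOrder (OpWord Z)]

theorem fill_lt_fill (ho : IsMonomialOrder o) (C : Ctx Z) {u v : OpWord Z} (h : u < v) :
    C.fill u < C.fill v := by
  obtain ⟨q, hq⟩ := exists_starWord_fill_eq C
  rw [← hq]
  exact ho.2 u v q h

theorem lin_leadsWith (ho : IsMonomialOrder o) (C : Ctx Z) {f : FreeOpAlg k Z} {m : OpWord Z}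
    (h : f.LeadsWith m) : (C.lin f).LeadsWith (C.fill m) := by
  have hm : StrictMono C.fill := fun _ _ => fill_lt_fill ho C
  constructor
  · rw [← h.1]
    exact Finsupp.mapDomain_apply hm.injective f.coeff m
  · intro m' hm'
    by_cases h' : m' ∈ Set.range C.fill
    · obtain ⟨m', rfl⟩ := h'
      refine hm.monotone (h.2 m' ?_)
      rwa [← show (C.lin f).coeff (C.fill m') = f.coeff m' from
        Finsupp.mapDomain_apply hm.injective f.coeff m']
    · exact absurd (Finsupp.mapDomain_of_notMem_range f.coeff m' h') hm'

end Ctx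

/-! ### The composition–diamond lemma -/

section Diamond

variable {k Z : Type*} [Field k]

section
variable [o : LinearOrder (OpWord Z)]

/-- The elements of `k𝔐(Z)` which are trivial modulo `(G, w)`. -/
def trivialSpan (G : Set (FreeOpAlg k Z)) (w : OpWord Z) : Submodule k (FreeOpAlg k Z) :=
  Submodule.span k {h | ∃ s ∈ G, ∃ C : Ctx Z, C.fill (leadMon o s) < w ∧ h = C.lin s}

theorem isTrivialMod_iff {G : Set (FreeOpAlg k Z)} {w : OpWord Z} {f : FreeOpAlg k Z} :
    IsTrivialMod o G w f ↔ f ∈ trivialSpan G w := by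
  suffices h : {h | ∃ s ∈ G, ∃ q : StarWord Z, o.lt (q.fill (leadMon o s)) w ∧
      h = q.fillLin s} = {h | ∃ s ∈ G, ∃ C : Ctx Z, C.fill (leadMon o s) < w ∧ h = C.lin s} by
    rw [IsTrivialMod, trivialSpan, h]
  ext h
  refine exists_congr fun s => and_congr_right fun hs => ⟨?_, ?_⟩
  · rintro ⟨q, hq, rfl⟩
    obtain ⟨C, hC⟩ := Ctx.exists_fill_eq_starWord_fill q
    exact ⟨C, hC ▸ hq, by rw [Ctx.fillLin_eq_lin hC]⟩
  · rintro ⟨C, hC, rfl⟩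
    obtain ⟨q, hq⟩ := Ctx.exists_starWord_fill_eq C
    exact ⟨q, hq ▸ hC, by rw [Ctx.fillLin_eq_lin hq]⟩

/-- Since `|w| = |f̄| + |u| = |v| + |ḡ|`, the lower bound on `|w|` says that `u` and `v` are
nonempty, and the upper bound that the overlap is nonempty. -/
theorem isOperatedGSBasis_iff {G : Set (FreeOpAlg k Z)} :
    IsOperatedGSBasis o G ↔ ∀ f ∈ G, ∀ g ∈ G, f ≠ 0 → g ≠ 0 →
      (∀ u v : OpWord Z, leadMon o f * u = v * leadMon o g →
        v.breadth < (leadMon o f).breadth → u.breadth < (leadMon o g).breadth →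
        u ≠ 1 → v ≠ 1 →
        monicize o f * of k _ u - of k _ v * monicize o g ∈ trivialSpan G (leadMon o f * u)) ∧
      (∀ C : Ctx Z, leadMon o f = C.fill (leadMon o g) →
        monicize o f - C.lin (monicize o g) ∈ trivialSpan G (leadMon o f)) := by
  simp only [IsOperatedGSBasis, isTrivialMod_iff]
  refine forall_congr' fun f => forall_congr' fun _ => forall_congr' fun g =>
    forall_congr' fun _ => forall_congr' fun _ => forall_congr' fun _ => and_congr ?_ ?_
  · constructor
    · intro h u v e h1 h2 h3 h4
      have hb := congrArg breadth e
      rw [← breadth_ne_zero] at h3 h4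
      simp only [breadth_mul] at hb
      exact h _ u v rfl e (by simp only [breadth_mul, max_lt_iff]; omega)
        (by simp only [breadth_mul]; omega)
    · rintro h _ u v rfl e h1 h2
      have hb := congrArg breadth e
      simp only [breadth_mul, max_lt_iff] at hb h1 h2
      exact h u v e (by omega) (by omega) (by rw [← breadth_ne_zero]; omega)
        (by rw [← breadth_ne_zero]; omega)
  · constructor
    · intro h C e
      obtain ⟨q, hq⟩ := Ctx.exists_starWord_fill_eq C
      rw [← Ctx.fillLin_eq_lin hq]
      exact h _ q rfl (by rw [hq, e])
    · rintro h _ q rfl e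
      obtain ⟨C, hC⟩ := Ctx.exists_fill_eq_starWord_fill q
      rw [Ctx.fillLin_eq_lin hC]
      exact h C (by rw [← hC, e])

theorem trivialSpan_mono {G H : Set (FreeOpAlg k Z)} (h : G ⊆ H) (w : OpWord Z) :
    trivialSpan G w ≤ trivialSpan H w :=
  Submodule.span_mono fun _ ⟨s, hs, hx⟩ => ⟨s, h hs, hx⟩

theorem lin_mem_trivialSpan {G : Set (FreeOpAlg k Z)} {s : FreeOpAlg k Z} (hs : s ∈ G)
    {C : Ctx Z} {w : OpWord Z} (h : C.fill (leadMon o s) < w) : C.lin s ∈ trivialSpan G w :=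
  Submodule.subset_span ⟨s, hs, C, h, rfl⟩

theorem lin_monicize_mem_trivialSpan {G : Set (FreeOpAlg k Z)} {s : FreeOpAlg k Z} (hs : s ∈ G)
    {C : Ctx Z} {w : OpWord Z} (h : C.fill (leadMon o s) < w) :
    C.lin (monicize o s) ∈ trivialSpan G w := by
  rw [monicize, map_smul]
  exact Submodule.smul_mem _ _ (lin_mem_trivialSpan hs h)

theorem map_lin_mem_trivialSpan (ho : IsMonomialOrder o) {G : Set (FreeOpAlg k Z)}
    {f : FreeOpAlg k Z} {w : OpWord Z} (hf : f ∈ trivialSpan G w) (C : Ctx Z) :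
    C.lin f ∈ trivialSpan G (C.fill w) := by
  induction hf using Submodule.span_induction with
  | mem x hx =>
    obtain ⟨s, hs, D, hD, rfl⟩ := hx
    rw [← Ctx.lin_comp]
    refine lin_mem_trivialSpan hs ?_
    rw [Ctx.fill_comp]
    exact Ctx.fill_lt_fill ho C hD
  | zero => simp
  | add x y _ _ hx hy => rw [map_add]; exact add_mem hx hy
  | smul c x _ hx => rw [map_smul]; exact Submodule.smul_mem _ c hx

/-- For monic `f` and `g`, `f ḡ - f̄ g = (f - f̄) g - f (g - ḡ)`. Expanding the lower terms `f - f̄`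
and `g - ḡ` into monomials leaves elements of the required kind. -/
theorem lin_sub_lin_mem_of_disjoint (ho : IsMonomialOrder o) {G : Set (FreeOpAlg k Z)}
    {f g : FreeOpAlg k Z} (hf : f ∈ G) (hg : g ∈ G) (hf0 : f ≠ 0) (hg0 : g ≠ 0)
    {C₁ C₂ E D₁ D₂ : Ctx Z}
    (h₁ : ∀ t, C₁.fill t = E.fill (D₁.fill t * D₂.fill (leadMon o g)))
    (h₂ : ∀ t, C₂.fill t = E.fill (D₁.fill (leadMon o f) * D₂.fill t)) :
    C₁.lin (monicize o f) - C₂.lin (monicize o g) ∈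
      trivialSpan G (C₁.fill (leadMon o f)) := by
  have e1 : ∀ x : FreeOpAlg k Z, ∀ m,
      E.lin (D₁.lin x * D₂.lin (single m 1)) =
        (E.comp ((Ctx.flat 1 (D₂.fill m)).comp D₁)).lin x := fun x m => by
    simp [Ctx.lin_comp, Ctx.lin_flat, ← one_def]
  have e2 : ∀ x : FreeOpAlg k Z, ∀ m,
      E.lin (D₁.lin (single m 1) * D₂.lin x) =
        (E.comp ((Ctx.flat (D₁.fill m) 1).comp D₂)).lin x := fun x m => by
    simp [Ctx.lin_comp, Ctx.lin_flat, ← one_def]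
  have hC₁ : C₁.lin (monicize o f) =
      E.lin (D₁.lin (monicize o f) * D₂.lin (single (leadMon o g) 1)) := by
    rw [e1, Ctx.lin_congr (C := C₁)
      (D := E.comp ((Ctx.flat 1 (D₂.fill (leadMon o g))).comp D₁)) (by simp [h₁])]
  have hC₂ : C₂.lin (monicize o g) =
      E.lin (D₁.lin (single (leadMon o f) 1) * D₂.lin (monicize o g)) := by
    rw [e2, Ctx.lin_congr (C := C₂)
      (D := E.comp ((Ctx.flat (D₁.fill (leadMon o f)) 1).comp D₂)) (by simp [h₂])]
  have e3 : C₁.lin (monicize o f) - C₂.lin (monicize o g) =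
      E.lin (D₁.lin (monicize o f - single (leadMon o f) 1) * D₂.lin (monicize o g)) -
      E.lin (D₁.lin (monicize o f) * D₂.lin (monicize o g - single (leadMon o g) 1)) := by
    rw [hC₁, hC₂]
    simp only [map_sub, sub_mul, mul_sub]
    abel
  rw [e3]
  refine sub_mem ?_ ?_
  · have hL : ∀ x, (E.lin ∘ₗ LinearMap.mulRight k (D₂.lin (monicize o g)) ∘ₗ D₁.lin) x =
        E.lin (D₁.lin x * D₂.lin (monicize o g)) := fun x => rfl
    rw [← hL]
    refine map_mem_of_forall_single_mem _ _ fun m hm => ?_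
    rw [hL, e2]
    refine lin_monicize_mem_trivialSpan hg ?_
    have := Ctx.fill_lt_fill ho (E.comp ((Ctx.flat 1 (D₂.fill (leadMon o g))).comp D₁))
      ((monicize_leadsWith hf0).sub_single m hm)
    simpa [h₁] using this
  · have hL : ∀ x, (E.lin ∘ₗ LinearMap.mulLeft k (D₁.lin (monicize o f)) ∘ₗ D₂.lin) x =
        E.lin (D₁.lin (monicize o f) * D₂.lin x) := fun x => rfl
    rw [← hL]
    refine map_mem_of_forall_single_mem _ _ fun m hm => ?_
    rw [hL, e1]
    refine lin_monicize_mem_trivialSpan hf ?_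
    have := Ctx.fill_lt_fill ho (E.comp ((Ctx.flat (D₁.fill (leadMon o f)) 1).comp D₂))
      ((monicize_leadsWith hg0).sub_single m hm)
    simpa [h₁] using this

/-- A nested pair is, up to sign, an inclusion composition in a context, and a proper overlap an
intersection composition in a context; contexts preserve triviality. -/
theorem lin_sub_lin_mem_of_position (ho : IsMonomialOrder o) {G : Set (FreeOpAlg k Z)}
    (hG : IsOperatedGSBasis o G) {f g : FreeOpAlg k Z} (hf : f ∈ G) (hg : g ∈ G)
    (hf0 : f ≠ 0) (hg0 : g ≠ 0) {C₁ C₂ : Ctx Z}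
    (h : Ctx.Position C₁ (leadMon o f) C₂ (leadMon o g)) :
    C₁.lin (monicize o f) - C₂.lin (monicize o g) ∈
      trivialSpan G (C₁.fill (leadMon o f)) := by
  rw [isOperatedGSBasis_iff] at hG
  obtain ⟨D, h1, h2⟩ | ⟨E, x, y, z, hx, hy, hz, h1, h2, h3, h4⟩ | ⟨E, D₁, D₂, h1, h2⟩ := h
  · have := map_lin_mem_trivialSpan ho ((hG g hg f hf hg0 hf0).2 D h1) C₂
    rw [h2, ← h1, Ctx.lin_congr (C := C₁) (D := C₂.comp D) (by simp [h2]),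
      Ctx.lin_comp, ← neg_sub, ← map_sub]
    exact neg_mem this
  · have key := (hG f hf g hg hf0 hg0).1 z x (by rw [h1, h2, mul_assoc]) ?_ ?_ hz hx
    · have := map_lin_mem_trivialSpan ho key E
      rw [h3, Ctx.lin_congr (C := C₁) (D := E.comp (Ctx.flat 1 z)) (by simp [h3]),
        Ctx.lin_congr (C := C₂) (D := E.comp (Ctx.flat x 1)) (by simp [h4]),
        Ctx.lin_comp, Ctx.lin_comp, Ctx.lin_flat, Ctx.lin_flat, ← map_sub, map_one, one_mul,
        mul_one]
      exact this
    · rw [← breadth_ne_zero] at hy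
      rw [h1, breadth_mul]
      omega
    · rw [← breadth_ne_zero] at hy
      rw [h2, breadth_mul]
      omega
  · exact lin_sub_lin_mem_of_disjoint ho hf hg hf0 hg0 h1 h2

theorem lin_sub_lin_mem_trivialSpan (ho : IsMonomialOrder o) {G : Set (FreeOpAlg k Z)}
    (hG : IsOperatedGSBasis o G) {f g : FreeOpAlg k Z} (hf : f ∈ G) (hg : g ∈ G)
    (hf0 : f ≠ 0) (hg0 : g ≠ 0) {C₁ C₂ : Ctx Z}
    (h : C₁.fill (leadMon o f) = C₂.fill (leadMon o g)) :
    C₁.lin (monicize o f) - C₂.lin (monicize o g) ∈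
      trivialSpan G (C₁.fill (leadMon o f)) := by
  obtain h' | h' := Ctx.position_or h
  · exact lin_sub_lin_mem_of_position ho hG hf hg hf0 hg0 h'
  · have := lin_sub_lin_mem_of_position ho hG hg hf hg0 hf0 h'
    rw [h, ← neg_sub]
    exact neg_mem this

end

/-- The span of the elements `C|_s` with `s ∈ G`. -/
def ctxSpan (G : Set (FreeOpAlg k Z)) : Submodule k (FreeOpAlg k Z) :=
  Submodule.span k {h | ∃ s ∈ G, ∃ C : Ctx Z, h = C.lin s}

section
variable [o : LinearOrder (OpWord Z)]

/-- The monic elements `C|_s` with `0 ≠ s ∈ G`. -/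
def ctxFamily (G : Set (FreeOpAlg k Z)) (i : Ctx Z × {s : FreeOpAlg k Z // s ∈ G ∧ s ≠ 0}) :
    FreeOpAlg k Z := i.1.lin (monicize o i.2.1)

/-- The leading monomial of `ctxFamily G i`. -/
def ctxLead (G : Set (FreeOpAlg k Z)) (i : Ctx Z × {s : FreeOpAlg k Z // s ∈ G ∧ s ≠ 0}) :
    OpWord Z := i.1.fill (leadMon o i.2.1)

theorem ctxFamily_leadsWith (ho : IsMonomialOrder o) (G : Set (FreeOpAlg k Z)) (i) :
    (ctxFamily G i).LeadsWith (ctxLead G i) :=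
  Ctx.lin_leadsWith ho _ (monicize_leadsWith i.2.2.2)

theorem lin_mem_span_of_ctxFamily_mem {G : Set (FreeOpAlg k Z)} {C : Ctx Z} {s : FreeOpAlg k Z}
    (hs : s ∈ G) {T : Set (Ctx Z × {s : FreeOpAlg k Z // s ∈ G ∧ s ≠ 0})}
    (h : ∀ h0 : s ≠ 0, (C, ⟨s, hs, h0⟩) ∈ T) :
    C.lin s ∈ Submodule.span k (ctxFamily G '' T) := by
  by_cases h0 : s = 0
  · simp [h0]
  · rw [← leadCoeff_smul_monicize (o := o) h0, map_smul]
    exact Submodule.smul_mem _ _ (Submodule.subset_span ⟨_, h h0, rfl⟩)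

theorem trivialSpan_eq (G : Set (FreeOpAlg k Z)) (w : OpWord Z) :
    trivialSpan G w = Submodule.span k (ctxFamily G '' {i | ctxLead G i < w}) := by
  refine le_antisymm (Submodule.span_le.2 ?_) (Submodule.span_le.2 ?_)
  · rintro _ ⟨s, hs, C, hC, rfl⟩
    exact lin_mem_span_of_ctxFamily_mem hs fun h0 => hC
  · rintro _ ⟨i, hi, rfl⟩
    exact lin_monicize_mem_trivialSpan i.2.2.1 hi

theorem ctxSpan_eq (G : Set (FreeOpAlg k Z)) :
    ctxSpan G = Submodule.span k (Set.range (ctxFamily G)) := by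
  refine le_antisymm (Submodule.span_le.2 ?_) (Submodule.span_le.2 ?_)
  · rintro _ ⟨s, hs, C, rfl⟩
    rw [← Set.image_univ]
    exact lin_mem_span_of_ctxFamily_mem hs fun h0 => Set.mem_univ _
  · rintro _ ⟨i, rfl⟩
    rw [ctxFamily, monicize, map_smul]
    exact Submodule.smul_mem _ _ (Submodule.subset_span ⟨_, i.2.2.1, _, rfl⟩)

theorem ctxFamily_confluent (ho : IsMonomialOrder o) {G : Set (FreeOpAlg k Z)}
    (hG : IsOperatedGSBasis o G) (i j) (h : ctxLead G i = ctxLead G j) :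
    ctxFamily G i - ctxFamily G j ∈
      Submodule.span k (ctxFamily G '' {m | ctxLead G m < ctxLead G i}) := by
  rw [← trivialSpan_eq]
  exact lin_sub_lin_mem_trivialSpan ho hG i.2.2.1 j.2.2.1 i.2.2.2 j.2.2.2 h

/-- The composition–diamond lemma for an operated Gröbner–Shirshov basis. -/
theorem mem_trivialSpan_of_mem_ctxSpan (ho : IsMonomialOrder o) {G : Set (FreeOpAlg k Z)}
    (hG : IsOperatedGSBasis o G) {f : FreeOpAlg k Z} (hf : f ∈ ctxSpan G) {w : OpWord Z}
    (hw : ∀ m, f.coeff m ≠ 0 → m < w) : f ∈ trivialSpan G w := by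
  have : WellFoundedLT (OpWord Z) := ⟨ho.1⟩
  rw [ctxSpan_eq] at hf
  rw [trivialSpan_eq]
  exact mem_span_lt_of_mem_span (ctxFamily_leadsWith ho G) (ctxFamily_confluent ho hG) hf hw

/-- The irreducible words form a basis of the quotient by an operated Gröbner–Shirshov basis. -/
theorem exists_basis_irr (ho : IsMonomialOrder o) {G : Set (FreeOpAlg k Z)}
    (hG : IsOperatedGSBasis o G) {V : Type*} [AddCommGroup V] [Module k V]
    (π : FreeOpAlg k Z →ₗ[k] V) (hπ : Function.Surjective π)
    (hker : LinearMap.ker π = ctxSpan G) :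
    ∃ b : Module.Basis (Irr o G) k V, ∀ m, b m = π (single m.1 1) := by
  have : WellFoundedLT (OpWord Z) := ⟨ho.1⟩
  rw [ctxSpan_eq] at hker
  refine exists_basis_of_confluent (ctxFamily_leadsWith ho G) (ctxFamily_confluent ho hG) π hπ
    hker _ fun m => not_congr ⟨?_, ?_⟩
  · rintro ⟨s, hs, h0, q, rfl⟩
    obtain ⟨C, hC⟩ := Ctx.exists_fill_eq_starWord_fill q
    exact ⟨(C, ⟨s, hs, h0⟩), by rw [hC]; rfl⟩
  · rintro ⟨⟨C, ⟨s, hs, h0⟩⟩, rfl⟩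
    obtain ⟨q, hq⟩ := Ctx.exists_starWord_fill_eq C
    exact ⟨s, hs, h0, q, by rw [hq]; rfl⟩

end

end Diamond

/-! ### Gröbner–Shirshov bases of `k𝓜(Z)` in `k𝔐(Z)` -/

section Assoc

variable {k Z : Type*} [Field k]

theorem coeff_freeAlgIncl_ofFree (g : MonoidAlgebra k (FreeMonoid Z)) (m : FreeMonoid Z) :
    (freeAlgIncl k Z g).coeff (ofFree Z m) = g.coeff m :=
  Finsupp.mapDomain_apply (ofFree_injective Z) g.coeff m

theorem isFlat_of_coeff_freeAlgIncl_ne_zero {g : MonoidAlgebra k (FreeMonoid Z)} {w : OpWord Z}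
    (h : (freeAlgIncl k Z g).coeff w ≠ 0) : IsFlat w := by
  by_contra hw
  exact h (Finsupp.mapDomain_of_notMem_range g.coeff w hw)

@[simp] theorem freeAlgIncl_single (m : FreeMonoid Z) (c : k) :
    freeAlgIncl k Z (single m c) = single (ofFree Z m) c := by
  simp [freeAlgIncl]

theorem freeAlgIncl_of (m : FreeMonoid Z) :
    freeAlgIncl k Z (MonoidAlgebra.of k _ m) = MonoidAlgebra.of k _ (ofFree Z m) := by simp

variable [o : LinearOrder (OpWord Z)]

theorem leadMon_freeAlgIncl (g : MonoidAlgebra k (FreeMonoid Z)) :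
    leadMon o (freeAlgIncl k Z g) = ofFree Z (leadMon (restrictOrder o) g) := by
  by_cases hg : g = 0
  · subst hg
    -- Both leading monomials take the default value `1`.
    rw [map_zero, leadMon, leadMon, dif_neg (by simp), dif_neg (by simp), map_one]
  · refine leadMon_eq ?_ fun m' hm' => ?_
    · rw [coeff_freeAlgIncl_ofFree]
      exact leadMon_mem_support (o := restrictOrder o) hg
    · obtain ⟨m, rfl⟩ := isFlat_of_coeff_freeAlgIncl_ne_zero hm'
      rw [coeff_freeAlgIncl_ofFree] at hm'
      exact le_leadMon (o := restrictOrder o) hm'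

theorem monicize_freeAlgIncl (g : MonoidAlgebra k (FreeMonoid Z)) :
    monicize o (freeAlgIncl k Z g) = freeAlgIncl k Z (monicize (restrictOrder o) g) := by
  rw [monicize, monicize, map_smul, leadCoeff, leadCoeff, leadMon_freeAlgIncl,
    coeff_freeAlgIncl_ofFree]

theorem freeAlgIncl_mem_trivialSpan {G : Set (MonoidAlgebra k (FreeMonoid Z))} {w : FreeMonoid Z}
    {f : MonoidAlgebra k (FreeMonoid Z)} (h : IsTrivialModAssoc (restrictOrder o) G w f) :
    freeAlgIncl k Z f ∈ trivialSpan (freeAlgIncl k Z '' G) (ofFree Z w) := by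
  induction h using Submodule.span_induction with
  | mem x hx =>
    obtain ⟨s, hs, a, b, hlt, rfl⟩ := hx
    rw [map_mul, map_mul, freeAlgIncl_of, freeAlgIncl_of, ← Ctx.lin_flat]
    refine lin_mem_trivialSpan (Set.mem_image_of_mem _ hs) ?_
    rw [leadMon_freeAlgIncl, Ctx.fill_flat, ← map_mul, ← map_mul]
    exact hlt
  | zero => simp
  | add x y _ _ hx hy => rw [map_add]; exact add_mem hx hy
  | smul c x _ hx => rw [map_smul]; exact Submodule.smul_mem _ c hx

/-- Passing to operated words creates no new compositions: all factors of a bracket-free word are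
bracket-free, and no hole inside a bracket can occur. -/
theorem isOperatedGSBasis_freeAlgIncl {G : Set (MonoidAlgebra k (FreeMonoid Z))}
    (hG : IsGSBasisAssoc (restrictOrder o) G) : IsOperatedGSBasis o (freeAlgIncl k Z '' G) := by
  rw [isOperatedGSBasis_iff]
  rintro _ ⟨f, hf, rfl⟩ _ ⟨g, hg, rfl⟩ hf0 hg0
  obtain ⟨h1, h2⟩ := hG f hf g hg (by rintro rfl; simp at hf0) (by rintro rfl; simp at hg0)
  simp only [leadMon_freeAlgIncl, monicize_freeAlgIncl]
  constructor
  · intro u v e hv hu hu1 hv1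
    rw [← breadth_ne_zero] at hu1 hv1
    obtain ⟨z, rfl, -⟩ | ⟨z, h3, h4⟩ := levi e
    · rw [breadth_mul] at hv
      omega
    obtain ⟨v, rfl⟩ := (isFlat_mul.1 (h3 ▸ isFlat_ofFree _)).1
    obtain ⟨u, rfl⟩ := (isFlat_mul.1 (h4 ▸ isFlat_ofFree _)).2
    simp only [breadth_ofFree] at hv hu hu1 hv1
    rw [← map_mul, ← map_mul] at e
    have e' := ofFree_injective Z e
    have e'' := congrArg FreeMonoid.length e'
    simp only [FreeMonoid.length_mul] at e''
    rw [← freeAlgIncl_of, ← freeAlgIncl_of, ← map_mul (freeAlgIncl k Z),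
      ← map_mul (freeAlgIncl k Z), ← map_sub, ← map_mul]
    refine freeAlgIncl_mem_trivialSpan (h1 _ u v rfl e' ?_ ?_)
    · rw [max_lt_iff, FreeMonoid.length_mul]
      omega
    · rw [FreeMonoid.length_mul]
      omega
  · intro C e
    cases C with
    | nest u C v =>
      have h := e ▸ isFlat_ofFree (leadMon (restrictOrder o) f)
      rw [Ctx.fill_nest, isFlat_mul, isFlat_mul] at h
      exact absurd h.1.2 not_isFlat_brk
    | flat u v =>
      have h := e ▸ isFlat_ofFree (leadMon (restrictOrder o) f)
      rw [Ctx.fill_flat, isFlat_mul, isFlat_mul] at h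
      obtain ⟨⟨⟨u, rfl⟩, -⟩, ⟨v, rfl⟩⟩ := h
      rw [Ctx.fill_flat, ← map_mul, ← map_mul] at e
      rw [Ctx.lin_flat, ← freeAlgIncl_of, ← freeAlgIncl_of, ← map_mul, ← map_mul, ← map_sub]
      exact freeAlgIncl_mem_trivialSpan (h2 _ u v rfl (ofFree_injective Z e))

end Assoc

/-! ### Bracket-free subwords of substituted words -/

namespace OpWord

variable {X Z : Type*}

theorem IsFlat.exists_of_mul {c : OpWord Z} (hc : IsFlat c) (h1 : c ≠ 1) :
    ∃ z c', c = of z * c' := by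
  induction c using induction_mul with
  | one => exact absurd rfl h1
  | of_mul z w _ => exact ⟨z, w, rfl⟩
  | brk_mul u w _ _ => exact absurd hc not_isFlat_brk_mul

theorem IsFlat.exists_mul_of {c : OpWord Z} (hc : IsFlat c) (h1 : c ≠ 1) :
    ∃ c' z, c = c' * of z := by
  obtain rfl | h | ⟨v, u, rfl⟩ := eq_one_or_eq_mul c
  · exact absurd rfl h1
  · exact h
  · exact absurd (isFlat_mul.1 hc).2 not_isFlat_brk

theorem mul_brk_ne_mul_of {u v w : OpWord Z} {z : Z} : u * brk w ≠ v * of z := by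
  intro h
  obtain ⟨a, -, h⟩ | ⟨a, -, h⟩ := levi h
  all_goals
    have hb := congrArg breadth h
    simp only [breadth_mul, breadth_of, breadth_brk] at hb
    obtain rfl : a = 1 := breadth_eq_zero.1 (by omega)
    rw [one_mul] at h
    exact nomatch h

/-- No two letters of the word are adjacent. -/
def NoAdjacent (m : OpWord X) : Prop := ∀ (C : Ctx X) (x y : X), m ≠ C.fill (of x * of y)

theorem NoAdjacent.of_fill {m : OpWord X} {C : Ctx X} (h : NoAdjacent (C.fill m)) :
    NoAdjacent m := by
  rintro D x y rfl
  exact h (C.comp D) x y (by simp)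

theorem NoAdjacent.right {u v : OpWord X} (h : NoAdjacent (u * v)) : NoAdjacent v :=
  NoAdjacent.of_fill (C := Ctx.flat u 1) (by simpa using h)

theorem NoAdjacent.left {u v : OpWord X} (h : NoAdjacent (u * v)) : NoAdjacent u :=
  NoAdjacent.of_fill (C := Ctx.flat 1 v) (by simpa using h)

theorem NoAdjacent.of_brk {u : OpWord X} (h : NoAdjacent (brk u)) : NoAdjacent u :=
  NoAdjacent.of_fill (C := Ctx.nest 1 (Ctx.flat 1 1) 1) (by simpa using h)

variable {θ : X → OpWord Z}

/-- What follows a letter is empty or starts with a bracket, and substitution does not change this.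
Hence a bracket-free word cannot run beyond the value of `x`. -/
theorem NoAdjacent.eq_one_of_subst_eq_mul {x : X} {w : OpWord X} (h : NoAdjacent (of x * w))
    {c v : OpWord Z} (hc : IsFlat c) (e : subst θ w = c * v) : c = 1 := by
  by_contra h1
  obtain ⟨z, c, rfl⟩ := hc.exists_of_mul h1
  induction w using induction_mul with
  | one => simp [mul_assoc] at e
  | of_mul y w _ => exact h (Ctx.flat 1 w) x y (by simp [mul_assoc])
  | brk_mul u w _ _ => simp [mul_assoc] at e

theorem NoAdjacent.eq_one_of_subst_eq_mul' {x : X} {w : OpWord X} (h : NoAdjacent (w * of x))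
    {c v : OpWord Z} (hc : IsFlat c) (e : subst θ w = v * c) : c = 1 := by
  by_contra h1
  obtain ⟨c, z, rfl⟩ := hc.exists_mul_of h1
  obtain rfl | ⟨w, y, rfl⟩ | ⟨w, u, rfl⟩ := eq_one_or_eq_mul w
  · simp at e
  · exact h (Ctx.flat w 1) y x (by simp [mul_assoc])
  · rw [map_mul, subst_brk, ← mul_assoc] at e
    exact mul_brk_ne_mul_of e

theorem NoAdjacent.exists_prefix {m : OpWord X} (h : NoAdjacent m) {c u : OpWord Z}
    (hc : IsFlat c) (h1 : c ≠ 1) (e : subst θ m = c * u) :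
    ∃ x m' u', m = of x * m' ∧ θ x = c * u' := by
  induction m using induction_mul with
  | one => simp [h1] at e
  | of_mul x w _ =>
    rw [map_mul, subst_of] at e
    obtain ⟨z, rfl, e'⟩ | ⟨z, hz, -⟩ := levi e
    · obtain rfl := h.eq_one_of_subst_eq_mul (isFlat_mul.1 hc).2 e'
      exact ⟨x, w, 1, rfl, by simp⟩
    · exact ⟨x, w, z, rfl, hz⟩
  | brk_mul r w _ _ =>
    obtain ⟨z, c, rfl⟩ := hc.exists_of_mul h1
    simp [mul_assoc] at e

theorem NoAdjacent.exists_suffix {m : OpWord X} (h : NoAdjacent m) {c u : OpWord Z}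
    (hc : IsFlat c) (h1 : c ≠ 1) (e : subst θ m = u * c) :
    ∃ x m' u', m = m' * of x ∧ θ x = u' * c := by
  obtain rfl | ⟨w, x, rfl⟩ | ⟨w, r, rfl⟩ := eq_one_or_eq_mul m
  · simp [h1] at e
  · rw [map_mul, subst_of] at e
    obtain ⟨z, -, hz⟩ | ⟨z, e', rfl⟩ := levi e
    · exact ⟨x, w, z, rfl, hz⟩
    · obtain rfl := h.eq_one_of_subst_eq_mul' (isFlat_mul.1 hc).1 e'
      exact ⟨x, w, 1, rfl, by simp⟩
  · obtain ⟨c, z, rfl⟩ := hc.exists_mul_of h1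
    rw [map_mul, subst_brk, ← mul_assoc] at e
    exact absurd e mul_brk_ne_mul_of

/-- An occurrence of a nonempty bracket-free word in `m(θ)`, where no two letters of `m` are
adjacent, lies within `θ x` for one of the letters `x` of `m`. -/
theorem NoAdjacent.exists_ctx {m : OpWord X} (h : NoAdjacent m) {c : OpWord Z}
    (hc : IsFlat c) (h1 : c ≠ 1) {C : Ctx Z} (e : subst θ m = C.fill c) :
    ∃ (x : X) (F : Ctx X) (E : Ctx Z), m = F.fill (of x) ∧ θ x = E.fill c ∧
      ∀ t, C.fill t = (F.subst θ).fill (E.fill t) := by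
  induction m using induction_mul generalizing C with
  | one =>
    cases C with
    | flat u v => simp [h1] at e
    | nest u C v => simp at e
  | of_mul x w ih =>
    rw [map_mul, subst_of] at e
    -- If the occurrence lies entirely to the right of `θ x`, the induction hypothesis for `w`
    -- applies.
    have step : ∀ C' : Ctx Z, (∀ t, C.fill t = θ x * C'.fill t) → subst θ w = C'.fill c →
        ∃ (y : X) (F : Ctx X) (E : Ctx Z), of x * w = F.fill (of y) ∧ θ y = E.fill c ∧
          ∀ t, C.fill t = (F.subst θ).fill (E.fill t) := by
      intro C' hC' e'
      obtain ⟨y, F, E, rfl, h2, h3⟩ := ih h.right e'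
      refine ⟨y, (Ctx.flat (of x) 1).comp F, E, by simp, h2, fun t => ?_⟩
      rw [hC', h3]
      cases F <;> simp [Ctx.comp, Ctx.subst, mul_assoc]
    cases C with
    | flat u v =>
      rw [Ctx.fill_flat, mul_assoc] at e
      obtain ⟨z, rfl, e'⟩ | ⟨z, hz, e'⟩ := levi e
      · exact step (Ctx.flat z v) (by simp [mul_assoc]) (by simpa [mul_assoc] using e')
      obtain ⟨z', rfl, rfl⟩ | ⟨z', rfl, e''⟩ := levi e'
      · exact ⟨x, Ctx.flat 1 w, Ctx.flat u z', by simp, by simpa [mul_assoc] using hz,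
          by simp [Ctx.subst, mul_assoc]⟩
      · obtain rfl := h.eq_one_of_subst_eq_mul (isFlat_mul.1 hc).2 e''
        rw [one_mul] at e''
        exact ⟨x, Ctx.flat 1 w, Ctx.flat u 1, by simp, by simpa using hz,
          by simp [Ctx.subst, e'']⟩
    | nest u C v =>
      rw [Ctx.fill_nest, mul_assoc] at e
      obtain ⟨z, rfl, e'⟩ | ⟨z, hz, e'⟩ := levi e
      · exact step (Ctx.nest z C v) (by simp [mul_assoc]) (by simpa [mul_assoc] using e')
      obtain ⟨z', rfl, rfl⟩ | ⟨z', hz', e''⟩ := levi e'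
      · exact ⟨x, Ctx.flat 1 w, Ctx.nest u C z', by simp, by simpa [mul_assoc] using hz,
          by simp [Ctx.subst, mul_assoc]⟩
      obtain ⟨rfl, rfl⟩ | ⟨rfl, rfl⟩ := mul_eq_brk hz'.symm
      · exact step (Ctx.nest 1 C v) (by simp [hz, mul_assoc]) (by simpa using e'')
      · rw [one_mul] at e''
        exact ⟨x, Ctx.flat 1 w, Ctx.nest u C 1, by simp, by simpa using hz,
          by simp [Ctx.subst, e'']⟩
  | brk_mul r w ih1 ih2 =>
    rw [map_mul, subst_brk] at e
    have step : ∀ C' : Ctx Z, (∀ t, C.fill t = brk (subst θ r) * C'.fill t) →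
        subst θ w = C'.fill c →
        ∃ (y : X) (F : Ctx X) (E : Ctx Z), brk r * w = F.fill (of y) ∧ θ y = E.fill c ∧
          ∀ t, C.fill t = (F.subst θ).fill (E.fill t) := by
      intro C' hC' e'
      obtain ⟨y, F, E, rfl, h2, h3⟩ := ih2 h.right e'
      refine ⟨y, (Ctx.flat (brk r) 1).comp F, E, by simp, h2, fun t => ?_⟩
      rw [hC', h3]
      cases F <;> simp [Ctx.comp, Ctx.subst, mul_assoc]
    cases C with
    | flat u v =>
      rw [Ctx.fill_flat, mul_assoc] at e
      obtain ⟨z, rfl, e'⟩ | ⟨z, hz, e'⟩ := levi e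
      · exact step (Ctx.flat z v) (by simp [mul_assoc]) (by simpa [mul_assoc] using e')
      obtain ⟨rfl, rfl⟩ | ⟨rfl, rfl⟩ := mul_eq_brk hz.symm
      · obtain ⟨z, c, rfl⟩ := hc.exists_of_mul h1
        simp [mul_assoc] at e'
      · exact step (Ctx.flat 1 v) (by simp [mul_assoc]) (by simpa using e'.symm)
    | nest u C v =>
      rw [Ctx.fill_nest, mul_assoc] at e
      obtain ⟨z, rfl, e'⟩ | ⟨z, hz, e'⟩ := levi e
      · exact step (Ctx.nest z C v) (by simp [mul_assoc]) (by simpa [mul_assoc] using e')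
      obtain ⟨rfl, rfl⟩ | ⟨rfl, rfl⟩ := mul_eq_brk hz.symm
      · rw [brk_mul_inj] at e'
        obtain ⟨e', rfl⟩ := e'
        obtain ⟨y, F, E, rfl, h2, h3⟩ := ih1 h.left.of_brk e'.symm
        exact ⟨y, Ctx.nest 1 F w, E, by simp, h2, by simp [Ctx.subst, h3]⟩
      · exact step (Ctx.nest 1 C v) (by simp [mul_assoc]) (by simpa using e'.symm)

end OpWord

/-! ### The letters of a word -/

namespace OpWord

variable {X Y Z : Type*}

/-- The list of the letters of a word, at all bracket depths. -/
def letters : OpWord Z → List Z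
  | one => []
  | letter z w => z :: letters w
  | bracket u w => letters u ++ letters w

@[simp] theorem letters_one : letters (1 : OpWord Z) = [] := rfl

@[simp] theorem letters_of_mul (z : Z) (w : OpWord Z) : letters (of z * w) = z :: letters w := rfl

@[simp] theorem letters_brk_mul (u w : OpWord Z) :
    letters (brk u * w) = letters u ++ letters w := rfl

@[simp] theorem letters_mul (u v : OpWord Z) : letters (u * v) = letters u ++ letters v := by
  induction u using induction_mul with
  | one => simp
  | of_mul z w ih => simp [mul_assoc, ih]
  | brk_mul u w _ ih => simp [mul_assoc, ih]

@[simp] theorem letters_brk (u : OpWord Z) : letters (brk u) = letters u := by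
  rw [← mul_one (brk u), letters_brk_mul, letters_one, List.append_nil]

@[simp] theorem letters_of (z : Z) : letters (of z) = [z] := rfl

theorem letters_subst (θ : X → OpWord Z) (m : OpWord X) :
    letters (subst θ m) = (letters m).flatMap fun x => letters (θ x) := by
  induction m using induction_mul with
  | one => simp
  | of_mul z w ih => simp [ih]
  | brk_mul u w ih1 ih2 => simp [ih1, ih2]

open Classical in
theorem count_letters (x : X) (m : OpWord X) : (letters m).count x = m.count x := by
  induction m using induction_mul with
  | one => simp
  | of_mul z w ih => simp [ih, List.count_cons, count_of, add_comm]
  | brk_mul u w ih1 ih2 => simp [ih1, ih2]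

theorem mem_letters {x : X} {m : OpWord X} : x ∈ letters m ↔ m.count x ≠ 0 := by
  classical
  rw [← count_letters, ← Nat.pos_iff_ne_zero, List.count_pos_iff]

/-- The image of a word under a map of letters. -/
def rename (f : Y → Z) : OpWord Y →* OpWord Z := subst fun y => of (f y)

theorem letters_rename (f : Y → Z) (w : OpWord Y) : letters (rename f w) = (letters w).map f := by
  rw [rename, letters_subst, List.map_eq_flatMap]
  rfl

@[simp] theorem rename_of (f : Y → Z) (y : Y) : rename f (of y) = of (f y) := subst_of _ _

@[simp] theorem rename_brk (f : Y → Z) (w : OpWord Y) : rename f (brk w) = brk (rename f w) :=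
  subst_brk _ _

theorem subst_rename (f : X → Y) (θ : Y → OpWord Z) (w : OpWord X) :
    subst θ (rename f w) = subst (fun x => θ (f x)) w := by
  simp [rename, subst_subst]

theorem rename_rename (f : X → Y) (g : Y → Z) (w : OpWord X) :
    rename g (rename f w) = rename (fun x => g (f x)) w := subst_rename _ _ _

/-- The bracket structure of a word. -/
def shape (w : OpWord Z) : OpWord Unit := rename (fun _ => ()) w

theorem shape_rename (f : Y → Z) (w : OpWord Y) : shape (rename f w) = shape w :=
  rename_rename _ _ _

theorem length_letters_eq_of_shape_eq {u : OpWord Y} {v : OpWord Z} (h : shape u = shape v) :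
    (letters u).length = (letters v).length := by
  have := congrArg (fun w => (letters w).length) h
  simpa [shape, letters_rename] using this

/-- The shape determines how many letters each bracket contains, hence how the list of letters is to
be split. -/
theorem ext_of_shape_of_letters {u v : OpWord Z} (hs : shape u = shape v)
    (hl : letters u = letters v) : u = v := by
  induction u using induction_mul generalizing v with
  | one =>
    induction v using induction_mul with
    | one => rfl
    | of_mul z w _ => simp [shape] at hs
    | brk_mul u w _ _ => simp [shape] at hs
  | of_mul z w ih =>
    induction v using induction_mul with
    | one => simp [shape] at hs
    | of_mul z' w' _ =>
      simp only [shape, map_mul, rename_of, of_mul_inj, true_and] at hs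
      simp only [letters_of_mul, List.cons.injEq] at hl
      rw [hl.1, ih hs hl.2]
    | brk_mul u w _ _ => simp [shape] at hs
  | brk_mul u w ih1 ih2 =>
    induction v using induction_mul with
    | one => simp [shape] at hs
    | of_mul z' w' _ => simp [shape] at hs
    | brk_mul u' w' _ _ =>
      simp only [shape, map_mul, rename_brk, brk_mul_inj] at hs
      simp only [letters_brk_mul] at hl
      obtain ⟨h1, h2⟩ := List.append_inj hl (length_letters_eq_of_shape_eq hs.1)
      rw [ih1 hs.1 h1, ih2 hs.2 h2]

theorem exists_shape_eq_letters_eq (w : OpWord Z) (l : List Y)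
    (h : l.length = (letters w).length) :
    ∃ w' : OpWord Y, letters w' = l ∧ shape w' = shape w := by
  induction w using induction_mul generalizing l with
  | one => exact ⟨1, by simpa [eq_comm] using h, by simp [shape]⟩
  | of_mul z w ih =>
    obtain _ | ⟨y, l⟩ := l
    · simp at h
    obtain ⟨w', h1, h2⟩ := ih l (by simpa using h)
    exact ⟨of y * w', by simp [h1], by simpa [shape] using h2⟩
  | brk_mul u w ih1 ih2 =>
    rw [letters_brk_mul, List.length_append] at h
    obtain ⟨u', h1, h2⟩ := ih1 (l.take (letters u).length) (by simp; omega)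
    obtain ⟨w', h3, h4⟩ := ih2 (l.drop (letters u).length) (by simp; omega)
    exact ⟨brk u' * w', by simp [h1, h3], by simpa [shape] using ⟨h2, h4⟩⟩

/-- The letters of a word can be made pairwise distinct. -/
theorem exists_nodup_rename_fst_eq (w : OpWord Z) :
    ∃ w' : OpWord (Z × ℕ), (letters w').Nodup ∧ rename Prod.fst w' = w := by
  obtain ⟨w', h1, h2⟩ := exists_shape_eq_letters_eq w (letters w).zipIdx (by simp)
  refine ⟨w', ?_, ext_of_shape_of_letters (by rw [shape_rename, h2]) ?_⟩
  · rw [h1]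
    refine List.Nodup.of_map Prod.snd ?_
    rw [List.zipIdx_map_snd]
    exact List.nodup_range'
  · rw [letters_rename, h1, List.zipIdx_map_fst]

/-- The group of all permutations of `Y` acts `n`-transitively for every `n`. -/
theorem exists_perm_map_eq {l₁ l₂ : List Y} (h₁ : l₁.Nodup) (h₂ : l₂.Nodup)
    (h : l₁.length = l₂.length) : ∃ σ : Equiv.Perm Y, l₁.map σ = l₂ := by
  have := Equiv.Perm.isMultiplyPretransitive Y l₁.length
  obtain ⟨σ, hσ⟩ := this.exists_smul_eq ⟨l₁.get, h₁.injective_get⟩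
    ⟨fun i => l₂.get (i.cast h), h₂.injective_get.comp (Fin.cast_injective h)⟩
  refine ⟨σ, List.ext_get (by simpa using h) fun n hn hn' => ?_⟩
  have := DFunLike.congr_fun hσ ⟨n, by simpa using hn⟩
  simpa using this

theorem exists_perm_rename_eq {u v : OpWord Y} (hs : shape u = shape v)
    (hu : (letters u).Nodup) (hv : (letters v).Nodup) :
    ∃ σ : Equiv.Perm Y, rename σ u = v := by
  obtain ⟨σ, hσ⟩ := exists_perm_map_eq hu hv (length_letters_eq_of_shape_eq hs)
  exact ⟨σ, ext_of_shape_of_letters (by rw [shape_rename, hs]) (by rw [letters_rename, hσ])⟩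

theorem rename_injOn {f : Y → Z} {L : Set Y} (hf : Set.InjOn f L) {u v : OpWord Y}
    (hu : ∀ y ∈ letters u, y ∈ L) (hv : ∀ y ∈ letters v, y ∈ L)
    (h : rename f u = rename f v) : u = v := by
  refine ext_of_shape_of_letters (by rw [← shape_rename f u, h, shape_rename]) ?_
  have hl := congrArg letters h
  rw [letters_rename, letters_rename] at hl
  generalize letters u = a at *
  generalize letters v = b at *
  clear h
  induction a generalizing b with
  | nil => simpa [eq_comm] using hl
  | cons x a ih =>
    obtain _ | ⟨y, b⟩ := b
    · simp at hl
    · simp only [List.map_cons, List.cons.injEq] at hl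
      rw [hf (hu x (by simp)) (hv y (by simp)) hl.1,
        ih (fun y hy => hu y (by simp [hy])) b (fun y hy => hv y (by simp [hy])) hl.2]

/-- Words which substitute independently for letters. -/
def code (d : Z) (n : ℕ) : OpWord Z := brk (of d ^ (n + 1))

theorem breadth_pow_of (d : Z) (n : ℕ) : (of d ^ n).breadth = n := by
  induction n with
  | zero => simp
  | succ n ih => simp [pow_succ, ih]

/-- A coded word is empty or starts with a bracket. The exponent `n + 1` in `code` excludes the
empty word, so the bracket coding a letter is never mistaken for a genuine bracket. -/
theorem pow_succ_ne_subst_code (d : Z) (n : ℕ) (u : OpWord ℕ) :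
    of d ^ (n + 1) ≠ subst (code d) u := by
  rw [pow_succ']
  induction u using induction_mul with
  | one => simp
  | of_mul z w _ => simp [code]
  | brk_mul u w _ _ => simp

theorem subst_code_injective (d : Z) : Function.Injective (subst (code d)) := by
  intro u
  induction u using induction_mul with
  | one =>
    intro v h
    induction v using induction_mul with
    | one => rfl
    | of_mul n w _ => simp [code] at h
    | brk_mul u w _ _ => simp at h
  | of_mul n w ih =>
    intro v h
    induction v using induction_mul with
    | one => simp [code] at h
    | of_mul n' w' _ =>
      simp only [map_mul, subst_of, code, brk_mul_inj] at h
      have hn := congrArg breadth h.1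
      rw [breadth_pow_of, breadth_pow_of, Nat.add_right_cancel_iff] at hn
      rw [hn, ih h.2]
    | brk_mul u w _ _ =>
      simp only [map_mul, subst_of, subst_brk, code, brk_mul_inj] at h
      exact absurd h.1 (pow_succ_ne_subst_code _ _ _)
  | brk_mul u w ih1 ih2 =>
    intro v h
    induction v using induction_mul with
    | one => simp at h
    | of_mul n' w' _ =>
      simp only [map_mul, subst_of, subst_brk, code, brk_mul_inj] at h
      exact absurd h.1.symm (pow_succ_ne_subst_code _ _ _)
    | brk_mul u' w' _ _ =>
      simp only [map_mul, subst_brk, brk_mul_inj] at h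
      rw [ih1 h.1, ih2 h.2]

end OpWord

/-! ### Substitution in operated polynomial identities -/

section SubstOPI

variable {k X Y Z : Type*} [Field k]

theorem lift_op_of (θ : X → OpWord Z) (m : OpWord X) :
    OpWord.lift (FreeOpAlg.op k Z) (fun x => MonoidAlgebra.of k (OpWord Z) (θ x)) m =
      MonoidAlgebra.of k _ (subst θ m) := by
  induction m using induction_mul with
  | one => simp only [map_one]
  | of_mul z w ih => rw [map_mul, map_mul, map_mul, ih, subst_of, OpWord.lift_of]
  | brk_mul u w ih1 ih2 =>
    rw [map_mul, map_mul, map_mul, ih2, subst_brk, OpWord.lift_brk, ih1]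
    simp [FreeOpAlg.op]

theorem substOPI_single (θ : X → OpWord Z) (m : OpWord X) (c : k) :
    substOPI θ (single m c) = single (subst θ m) c := by
  rw [substOPI, evalOPI, MonoidAlgebra.lift_single, lift_op_of]
  simp

theorem substOPI_eq (θ : X → OpWord Z) (φ : FreeOpAlg k X) :
    substOPI θ φ = mapDomain (subst θ) φ := by
  induction φ using MonoidAlgebra.induction_linear with
  | zero => simp
  | add f g hf hg => rw [map_add, mapDomain_add, hf, hg]
  | single m c => rw [substOPI_single, mapDomain_single]

theorem exists_of_coeff_substOPI_ne_zero {θ : X → OpWord Z} {φ : FreeOpAlg k X} {w : OpWord Z}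
    (h : (substOPI θ φ).coeff w ≠ 0) : ∃ m, φ.coeff m ≠ 0 ∧ subst θ m = w := by
  classical
  rw [substOPI_eq] at h
  have := Finsupp.mapDomain_support (Finsupp.mem_support_iff.2 h)
  simpa using this

theorem substOPI_substOPI (θ : X → OpWord Y) (ρ : Y → OpWord Z) (φ : FreeOpAlg k X) :
    substOPI ρ (substOPI θ φ) = substOPI (fun x => subst ρ (θ x)) φ := by
  induction φ using MonoidAlgebra.induction_linear with
  | zero => simp
  | add f g hf hg => simp only [map_add, hf, hg]
  | single m c => simp only [substOPI_single, subst_subst]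

/-- A nonzero coefficient can only disappear by cancelling against another one with the same image.
-/
theorem exists_ne_of_mapDomain_eq_zero {M N : Type*} {f : M → N} {x : MonoidAlgebra k M}
    (h : mapDomain f x = 0) {m : M} (hm : x.coeff m ≠ 0) :
    ∃ m', x.coeff m' ≠ 0 ∧ f m' = f m ∧ m' ≠ m := by
  classical
  by_contra! hc
  refine hm ?_
  have h0 : (mapDomain f x).coeff (f m) = 0 := by rw [h]; rfl
  rw [mapDomain, coeff_ofCoeff, Finsupp.mapDomain, Finsupp.sum_apply, Finsupp.sum,
    Finset.sum_eq_single m] at h0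
  · simpa using h0
  · intro m' hm' hne
    rw [Finsupp.single_apply, if_neg fun h => hne (hc m' (Finsupp.mem_support_iff.1 hm') h)]
  · intro h
    rw [Finsupp.notMem_support_iff.1 h, Finsupp.single_zero, Finsupp.zero_apply]

/-- If a multilinear identity, all of whose instances have the same monomial as leading monomial,
vanishes after a substitution of words, then it still vanishes when the occurrences of
letters in these words are replaced by arbitrary words. -/
theorem substOPI_eq_zero_of_rename [o : LinearOrder (OpWord Z)] (ho : WellFounded o.lt)
    (d : Z) {φ : FreeOpAlg k X} (hφ : IsMultilinearOPI φ) {P₀ : OpWord X} (hP₀ : φ.coeff P₀ ≠ 0)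
    (hlead : ∀ θ : X → OpWord Z, substOPI θ φ = 0 ∨ leadMon o (substOPI θ φ) = subst θ P₀)
    {W : Type*} (θ : X → OpWord W) (e : W → Z)
    (h0 : substOPI (fun x => rename e (θ x)) φ = 0) (ρ : W → OpWord Z) :
    substOPI (fun x => subst ρ (θ x)) φ = 0 := by
  choose lab hlab hlab' using fun x => exists_nodup_rename_fst_eq (θ x)
  -- Tagging each letter with its variable and its position makes every monomial of `φ(θ')` free of
  -- repeated letters, all over the same alphabet `L`.
  let θ' : X → OpWord (X × W × ℕ) := fun x => rename (fun y => (x, y)) (lab x)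
  have hsub : ∀ (ρ : W → OpWord Z) (x : X),
      subst (fun y : X × W × ℕ => ρ y.2.1) (θ' x) = subst ρ (θ x) := by
    intro ρ x
    simp only [θ', subst_rename]
    conv_rhs => rw [← hlab' x, subst_rename]
  obtain ⟨V, -, hV⟩ := hφ
  have hmem : ∀ m, φ.coeff m ≠ 0 → ∀ x, x ∈ letters m ↔ x ∈ V := by
    intro m hm x
    obtain ⟨h1, h2⟩ := hV m (Finsupp.mem_support_iff.2 hm)
    by_cases hx : x ∈ V
    · simp [mem_letters, hx, h1 x hx]
    · simp [mem_letters, hx, h2 x hx]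
  have hnodup : ∀ m, φ.coeff m ≠ 0 → (letters (subst θ' m)).Nodup := by
    classical
    intro m hm
    obtain ⟨h1, h2⟩ := hV m (Finsupp.mem_support_iff.2 hm)
    have hn : (letters m).Nodup := by
      rw [List.nodup_iff_count_le_one]
      intro x
      rw [count_letters]
      by_cases hx : x ∈ V
      · rw [h1 x hx]
      · rw [h2 x hx]
        exact zero_le_one
    rw [letters_subst, List.nodup_flatMap]
    refine ⟨fun x _ => ?_, hn.imp fun {x y} hxy => ?_⟩
    · rw [letters_rename]
      exact (hlab x).map fun a b h => (Prod.mk.inj h).2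
    · intro z hz1 hz2
      simp only [θ', letters_rename, List.mem_map] at hz1 hz2
      obtain ⟨a, -, rfl⟩ := hz1
      obtain ⟨b, -, hb⟩ := hz2
      exact hxy (Prod.mk.inj hb).1.symm
  let L : Set (X × W × ℕ) := {y | ∃ x ∈ V, y ∈ letters (θ' x)}
  have hL : ∀ m, φ.coeff m ≠ 0 → ∀ y, y ∈ letters (subst θ' m) ↔ y ∈ L := by
    intro m hm y
    simp [L, letters_subst, hmem m hm]
  suffices hψ : substOPI θ' φ = 0 by
    have := congrArg (substOPI fun y : X × W × ℕ => ρ y.2.1) hψ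
    rw [map_zero, substOPI_substOPI] at this
    simpa only [hsub] using this
  by_contra hψ
  let P := subst θ' P₀
  have hLfin : L.Countable := by
    have : L = ⋃ x ∈ V, {y | y ∈ letters (θ' x)} := by ext; simp [L]
    rw [this]
    exact V.countable_toSet.biUnion fun x _ => (List.finite_toSet _).countable
  -- The codes of the predicted leading word `P` under all injective labellings of `L`. The
  -- labelling attaining the least one is chosen.
  let S : Set (OpWord Z) :=
    {w | ∃ τ : X × W × ℕ → ℕ, Set.InjOn τ L ∧ w = subst (code d) (rename τ P)}
  obtain ⟨τ₀, hτ₀⟩ := Set.countable_iff_exists_injOn.1 hLfin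
  have hS : S.Nonempty := ⟨_, τ₀, hτ₀, rfl⟩
  obtain ⟨τ, hτ, hmin⟩ := ho.min_mem S hS
  have hinj : ∀ m m', φ.coeff m ≠ 0 → φ.coeff m' ≠ 0 →
      subst (code d) (rename τ (subst θ' m)) = subst (code d) (rename τ (subst θ' m')) →
      subst θ' m = subst θ' m' := fun m m' hm hm' h =>
    rename_injOn hτ (fun y hy => (hL m hm y).1 hy) (fun y hy => (hL m' hm' y).1 hy)
      (subst_code_injective d h)
  let γ : X → OpWord Z := fun x => subst (code d) (rename τ (θ' x))
  have hγ : substOPI γ φ = mapDomain (fun w => subst (code d) (rename τ w)) (substOPI θ' φ) := by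
    have : γ = fun x => subst (fun y => code d (τ y)) (θ' x) := by
      funext x
      simp only [γ, subst_rename]
    rw [this, ← substOPI_substOPI, substOPI_eq]
    congr 1
    funext w
    rw [subst_rename]
  have hγm : ∀ m, subst γ m = subst (code d) (rename τ (subst θ' m)) := by
    intro m
    simp only [γ, rename, subst_subst]
  have hγ0 : substOPI γ φ ≠ 0 := by
    intro h
    rw [hγ] at h
    obtain ⟨w, hw⟩ := Finsupp.ne_iff.1 (fun h' => hψ (coeff_eq_zero.1 h') :
      (substOPI θ' φ).coeff ≠ 0)
    obtain ⟨w', hw', he, hne⟩ := exists_ne_of_mapDomain_eq_zero h hw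
    obtain ⟨m, hm, rfl⟩ := exists_of_coeff_substOPI_ne_zero hw
    obtain ⟨m', hm', rfl⟩ := exists_of_coeff_substOPI_ne_zero hw'
    exact hne (hinj _ _ hm' hm he)
  have hlm : leadMon o (substOPI γ φ) = subst (code d) (rename τ P) :=
    ((hlead γ).resolve_left hγ0).trans (hγm P₀)
  have hcoeff : ∀ m, φ.coeff m ≠ 0 → (substOPI γ φ).coeff (subst γ m) =
      (substOPI θ' φ).coeff (subst θ' m) := by
    intro m hm
    rw [hγ, hγm]
    refine Finsupp.mapDomain_apply' {w | ∃ m, φ.coeff m ≠ 0 ∧ subst θ' m = w} _ ?_ ?_ ⟨m, hm, rfl⟩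
    · intro w hw
      exact exists_of_coeff_substOPI_ne_zero (Finsupp.mem_support_iff.1 hw)
    · rintro _ ⟨m, hm, rfl⟩ _ ⟨m', hm', rfl⟩ h
      exact hinj m m' hm hm' h
  -- Several monomials of `φ` may become equal under `θ'`, so `hP₀` alone does not suffice; `P`
  -- survives because its code is the leading monomial of the nonzero instance `φ(γ)`.
  have hP : (substOPI θ' φ).coeff P ≠ 0 := by
    rw [← hcoeff P₀ hP₀, hγm, ← hlm]
    exact leadMon_mem_support hγ0
  have h0' : mapDomain (rename fun y : X × W × ℕ => e y.2.1) (substOPI θ' φ) = 0 := by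
    have : mapDomain (rename fun y : X × W × ℕ => e y.2.1) (substOPI θ' φ) =
        substOPI (fun y : X × W × ℕ => of (e y.2.1)) (substOPI θ' φ) := (substOPI_eq _ _).symm
    rw [this, substOPI_substOPI, ← h0]
    congr 2
    funext x
    exact hsub (fun y => of (e y)) x
  -- After identification of letters `P` must cancel against some other `p`, which therefore has the
  -- same shape.
  obtain ⟨p, hp, hpe, hne⟩ := exists_ne_of_mapDomain_eq_zero h0' hP
  obtain ⟨m, hm, rfl⟩ := exists_of_coeff_substOPI_ne_zero hp
  have hs : shape P = shape (subst θ' m) := by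
    have := congrArg shape hpe
    rwa [shape_rename, shape_rename, eq_comm] at this
  obtain ⟨σ, hσ⟩ := exists_perm_rename_eq hs (hnodup P₀ hP₀) (hnodup m hm)
  have hσL : ∀ y ∈ L, σ y ∈ L := by
    intro y hy
    rw [← hL m hm, ← hσ, letters_rename]
    exact List.mem_map_of_mem ((hL P₀ hP₀ y).2 hy)
  -- The right side is the code of `P` under the labelling `τ ∘ σ`, which is also injective on `L`,
  -- so minimality applies.
  have hle : subst (code d) (rename τ P) ≤ subst (code d) (rename τ (subst θ' m)) := by
    rw [← hmin, ← hσ, rename_rename]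
    refine not_lt.1 (ho.not_lt_min S ⟨_, ?_, rfl⟩)
    intro a ha b hb hab
    exact σ.injective (hτ (hσL a ha) (hσL b hb) hab)
  -- The code of `P` is the leading monomial of `φ(γ)`.
  have hge : subst (code d) (rename τ (subst θ' m)) ≤ subst (code d) (rename τ P) := by
    rw [← hlm, ← hγm]
    exact le_leadMon (by rwa [hcoeff m hm])
  exact hne (hinj m P₀ hm hP₀ (le_antisymm hge hle))

end SubstOPI

/-! ### Substitutions with bracket-free values -/

namespace OpWord

variable {X Z : Type*}

theorem isFlat_of_isFlat_subst {θ : X → OpWord Z} {m : OpWord X} (h : IsFlat (subst θ m)) :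
    IsFlat m := by
  induction m using induction_mul with
  | one => exact isFlat_one
  | of_mul x w ih =>
    rw [map_mul, isFlat_mul] at h
    exact isFlat_of_mul.2 (ih h.2)
  | brk_mul u w _ _ =>
    rw [map_mul, subst_brk] at h
    exact absurd h not_isFlat_brk_mul

theorem isFlat_of_isFlat_fill {C : Ctx Z} {a : OpWord Z} (h : IsFlat (C.fill a)) : IsFlat a := by
  cases C with
  | flat u v =>
    rw [Ctx.fill_flat, isFlat_mul, isFlat_mul] at h
    exact h.1.2
  | nest u C v =>
    rw [Ctx.fill_nest, isFlat_mul, isFlat_mul] at h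
    exact absurd h.1.2 not_isFlat_brk

theorem IsFlat.subst_one {u : OpWord X} (h : IsFlat u) : subst (fun _ => (1 : OpWord Z)) u = 1 := by
  induction u using induction_mul with
  | one => exact map_one _
  | of_mul z w ih => rw [map_mul, subst_of, one_mul, ih (isFlat_of_mul.1 h)]
  | brk_mul u w _ _ => exact absurd h not_isFlat_brk_mul

theorem NoAdjacent.eq_one_or_of {m : OpWord X} (h : NoAdjacent m) (hm : IsFlat m) :
    m = 1 ∨ ∃ x, m = of x := by
  induction m using induction_mul with
  | one => exact Or.inl rfl
  | of_mul x w _ =>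
    refine Or.inr ⟨x, ?_⟩
    induction w using induction_mul with
    | one => exact mul_one _
    | of_mul y w _ => exact absurd (by simp [mul_assoc]) (h (Ctx.flat 1 w) x y)
    | brk_mul u w _ _ => exact absurd (isFlat_of_mul.1 hm) not_isFlat_brk_mul
  | brk_mul u w _ _ => exact absurd hm not_isFlat_brk_mul

theorem IsFlat.eq_of {m : OpWord X} (hm : IsFlat m) {x : X} (h1 : m.count x = 1)
    (h : ∀ y, m.count y ≠ 0 → y = x) : m = of x := by
  induction m using induction_mul with
  | one => simp at h1
  | of_mul y w _ =>
    obtain rfl := h y (by simp)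
    induction w using induction_mul with
    | one => exact mul_one _
    | of_mul z w _ =>
      obtain rfl := h z (by simp)
      simp at h1
    | brk_mul u w _ _ => exact absurd (isFlat_of_mul.1 hm) not_isFlat_brk_mul
  | brk_mul u w _ _ => exact absurd hm not_isFlat_brk_mul

end OpWord

/-! ### Mixed compositions and nonvanishing of instances -/

section Union

variable {k X Z : Type*} [Field k]

theorem lin_mem_ctxSpan {G : Set (FreeOpAlg k Z)} {f : FreeOpAlg k Z} (hf : f ∈ ctxSpan G)
    (C : Ctx Z) : C.lin f ∈ ctxSpan G := by
  induction hf using Submodule.span_induction with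
  | mem x hx =>
    obtain ⟨s, hs, D, rfl⟩ := hx
    rw [← Ctx.lin_comp]
    exact Submodule.subset_span ⟨s, hs, _, rfl⟩
  | zero => simp
  | add x y _ _ hx hy => rw [map_add]; exact add_mem hx hy
  | smul c x _ hx => rw [map_smul]; exact Submodule.smul_mem _ c hx

theorem subset_ctxSpan (G : Set (FreeOpAlg k Z)) : G ⊆ ctxSpan G := fun s hs =>
  Submodule.subset_span ⟨s, hs, Ctx.flat 1 1, by simp [Ctx.lin_flat, ← one_def]⟩

/-- A multilinear identity, as a function of one of its variables, extends linearly. -/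
theorem exists_linear_substOPI_update [DecidableEq X] {φ : FreeOpAlg k X} (θ : X → OpWord Z)
    {x : X} (hx : ∀ m, φ.coeff m ≠ 0 → m.count x = 1) :
    ∃ Λ : FreeOpAlg k Z →ₗ[k] FreeOpAlg k Z,
      (∀ t, Λ (single t 1) = substOPI (Function.update θ x t) φ) ∧
      ∀ (H : Set (FreeOpAlg k Z)), ∀ f ∈ ctxSpan H, Λ f ∈ ctxSpan H := by
  have hD : ∀ m, ∃ D : Ctx Z, φ.coeff m ≠ 0 →
      ∀ t, OpWord.subst (Function.update θ x t) m = D.fill t := by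
    intro m
    by_cases hm : φ.coeff m = 0
    · exact ⟨Ctx.flat 1 1, fun h => absurd hm h⟩
    · obtain ⟨D, hD⟩ := Ctx.exists_subst_update_eq θ (hx m hm)
      exact ⟨D, fun _ => hD⟩
  choose D hD using hD
  refine ⟨∑ m ∈ φ.coeff.support, φ.coeff m • (D m).lin, fun t => ?_, fun H f hf => ?_⟩
  · conv_rhs => rw [← sum_coeff_single φ, Finsupp.sum, map_sum]
    rw [LinearMap.sum_apply]
    refine Finset.sum_congr rfl fun m hm => ?_
    rw [substOPI_single, hD m (Finsupp.mem_support_iff.1 hm), LinearMap.smul_apply,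
      Ctx.lin_single, smul_single, smul_eq_mul, mul_one]
  · rw [LinearMap.sum_apply]
    exact Submodule.sum_mem _ fun m _ => Submodule.smul_mem _ _ (lin_mem_ctxSpan hf _)

variable [o : LinearOrder (OpWord Z)]

theorem MonoidAlgebra.LeadsWith.coeff_sub_lt {f g : FreeOpAlg k Z} {w : OpWord Z} (hf : f.LeadsWith w)
    (hg : g.LeadsWith w) {m : OpWord Z} (hm : (f - g).coeff m ≠ 0) : m < w := by
  by_cases h : (f - single w 1).coeff m = 0
  · refine hg.sub_single m fun h' => hm ?_
    rw [show f - g = (f - single w 1) - (g - single w 1) by abel, coeff_sub, Finsupp.sub_apply, h,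
      h', sub_zero]
  · exact hf.sub_single m h

theorem lt_of_coeff_ne_zero_of_mem_trivialSpan (ho : IsMonomialOrder o)
    {G : Set (FreeOpAlg k Z)} {w : OpWord Z} {f : FreeOpAlg k Z} (hf : f ∈ trivialSpan G w)
    {m : OpWord Z} (hm : f.coeff m ≠ 0) : m < w := by
  rw [trivialSpan_eq] at hf
  by_contra h
  refine hm (coeff_eq_zero_of_mem_span (ctxFamily_leadsWith ho G) (Submodule.span_mono
    (Set.image_mono fun i hi => ?_) hf))
  exact lt_of_lt_of_le hi (not_lt.1 h)

/-- The product `m s` has leading monomial `m`, so by induction every monomial below `w` is a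
combination of such products with `m < w`. -/
theorem mem_trivialSpan_of_leadMon_eq_one (ho : IsMonomialOrder o) {U : Set (FreeOpAlg k Z)}
    {s : FreeOpAlg k Z} (hs : s ∈ U) (hs0 : s ≠ 0) (hs1 : leadMon o s = 1) {w : OpWord Z}
    {f : FreeOpAlg k Z} (hf : ∀ m, f.coeff m ≠ 0 → m < w) : f ∈ trivialSpan U w := by
  have : WellFoundedLT (OpWord Z) := ⟨ho.1⟩
  have key : ∀ m, m < w → LinearMap.id (R := k) (single m (1 : k)) ∈ trivialSpan U w := by
    intro m
    induction m using WellFoundedLT.induction with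
    | ind m ih =>
      intro hm
      have h1 := Ctx.lin_leadsWith ho (Ctx.flat m 1) (monicize_leadsWith hs0)
      rw [hs1, Ctx.fill_flat, mul_one, mul_one] at h1
      have h2 : (Ctx.flat m 1).lin (monicize o s) ∈ trivialSpan U w :=
        lin_monicize_mem_trivialSpan hs (by simpa [hs1] using hm)
      have h3 := map_mem_of_forall_single_mem LinearMap.id (trivialSpan U w)
        fun m' hm' => ih m' (h1.sub_single m' hm') ((h1.sub_single m' hm').trans hm)
      rw [LinearMap.id_apply] at h3 ⊢
      exact (Submodule.sub_mem_iff_right _ h2).1 h3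
  exact map_mem_of_forall_single_mem LinearMap.id _ fun m hm => key m (hf m hm)

theorem isOperatedGSBasis_of_leadMon_eq_one (ho : IsMonomialOrder o) {U : Set (FreeOpAlg k Z)}
    {s : FreeOpAlg k Z} (hs : s ∈ U) (hs0 : s ≠ 0) (hs1 : leadMon o s = 1) :
    IsOperatedGSBasis o U := by
  rw [isOperatedGSBasis_iff]
  intro f hf g hg hf0 hg0
  constructor
  · intro u v e _ _ _ _
    have h1 := Ctx.lin_leadsWith ho (Ctx.flat 1 u) (monicize_leadsWith hf0)
    have h2 := Ctx.lin_leadsWith ho (Ctx.flat v 1) (monicize_leadsWith hg0)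
    rw [Ctx.lin_flat, Ctx.fill_flat, map_one, one_mul, one_mul] at h1
    rw [Ctx.lin_flat, Ctx.fill_flat, map_one, mul_one, mul_one, ← e] at h2
    exact mem_trivialSpan_of_leadMon_eq_one ho hs hs0 hs1 fun m hm => LeadsWith.coeff_sub_lt h1 h2 hm
  · intro C e
    have h2 := Ctx.lin_leadsWith ho C (monicize_leadsWith hg0)
    rw [← e] at h2
    exact mem_trivialSpan_of_leadMon_eq_one ho hs hs0 hs1
      fun m hm => LeadsWith.coeff_sub_lt (monicize_leadsWith hf0) h2 hm

theorem substOPI_mem_trivialSpan {Φ : Set (FreeOpAlg k X)} {φ : FreeOpAlg k X} (hφΦ : φ ∈ Φ)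
    {P₀ : OpWord X}
    (hlead : ∀ θ : X → OpWord Z, substOPI θ φ = 0 ∨ leadMon o (substOPI θ φ) = subst θ P₀)
    {θ : X → OpWord Z} {w : OpWord Z} (h : subst θ P₀ < w) :
    substOPI θ φ ∈ trivialSpan (SPhi Φ Z) w := by
  obtain h0 | h0 := hlead θ
  · rw [h0]
    exact zero_mem _
  · have := lin_mem_trivialSpan (G := SPhi Φ Z) ⟨φ, hφΦ, θ, rfl⟩ (C := Ctx.flat 1 1) (w := w)
      (by simpa [h0] using h)
    rwa [Ctx.lin_flat, map_one, one_mul, mul_one] at this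

/-- The inclusion composition of `φ(θ)` with an element of a Gröbner–Shirshov basis whose leading
monomial occurs within the value of a variable is trivial. -/
theorem monicize_substOPI_sub_lin_mem [DecidableEq X] (ho : IsMonomialOrder o)
    {Φ : Set (FreeOpAlg k X)}
    {φ : FreeOpAlg k X} (hφΦ : φ ∈ Φ) {x : X} (hx : ∀ m, φ.coeff m ≠ 0 → m.count x = 1)
    {F : Ctx X} (hP₀ : φ.coeff (F.fill (OpWord.of x)) ≠ 0)
    (hlead : ∀ θ : X → OpWord Z, substOPI θ φ = 0 ∨
      leadMon o (substOPI θ φ) = subst θ (F.fill (OpWord.of x)))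
    {H : Set (FreeOpAlg k Z)} (hH : IsOperatedGSBasis o H) {g : FreeOpAlg k Z} (hg : g ∈ H)
    (hg0 : g ≠ 0) {θ : X → OpWord Z} (hθ : substOPI θ φ ≠ 0) {E : Ctx Z}
    (hE : θ x = E.fill (leadMon o g)) :
    monicize o (substOPI θ φ) - (F.subst θ).lin (E.lin (monicize o g)) ∈
      trivialSpan (SPhi Φ Z ∪ H) (leadMon o (substOPI θ φ)) := by
  obtain ⟨Λ, hΛ, hΛH⟩ := exists_linear_substOPI_update θ hx
  have hF : ∀ t, subst (Function.update θ x t) (F.fill (OpWord.of x)) = (F.subst θ).fill t :=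
    Ctx.subst_update_fill θ (hx _ hP₀)
  have hw : leadMon o (substOPI θ φ) = ((F.subst θ).comp E).fill (leadMon o g) := by
    rw [(hlead θ).resolve_left hθ, Ctx.fill_comp, ← hF, ← hE, Function.update_eq_self]
  set w := leadMon o (substOPI θ φ) with hwdef
  set c := leadCoeff o (substOPI θ φ) with hc
  have hgm : monicize o g ∈ ctxSpan H := Submodule.smul_mem _ _ (subset_ctxSpan H hg)
  -- Each lower term of `g` gives an instance of `φ` which is zero or has leading monomial below
  -- `w`.
  have hR : Λ (E.lin (monicize o g - single (leadMon o g) 1)) ∈ trivialSpan (SPhi Φ Z) w := by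
    refine map_mem_of_forall_single_mem (Λ ∘ₗ E.lin) _ fun m hm => ?_
    rw [LinearMap.comp_apply, Ctx.lin_single, hΛ]
    refine substOPI_mem_trivialSpan hφΦ hlead ?_
    rw [hF, hw, Ctx.fill_comp]
    exact Ctx.fill_lt_fill ho _ (Ctx.fill_lt_fill ho _ ((monicize_leadsWith hg0).sub_single m hm))
  set R := Λ (E.lin (monicize o g - single (leadMon o g) 1)) with hRdef
  have hT : Λ (E.lin (monicize o g)) = substOPI θ φ + R := by
    rw [hRdef, map_sub, map_sub, Ctx.lin_single, hΛ, ← hE, Function.update_eq_self]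
    abel
  have e1 : monicize o (substOPI θ φ) - (F.subst θ).lin (E.lin (monicize o g)) =
      (c⁻¹ • Λ (E.lin (monicize o g)) - (F.subst θ).lin (E.lin (monicize o g))) - c⁻¹ • R := by
    rw [hT, smul_add, monicize]
    abel
  -- Both terms lie in the ideal of `H`, and their leading terms at `w` cancel, so the
  -- composition–diamond lemma for `H` applies.
  have h1 : c⁻¹ • Λ (E.lin (monicize o g)) - (F.subst θ).lin (E.lin (monicize o g)) ∈
      trivialSpan H w := by
    refine mem_trivialSpan_of_mem_ctxSpan ho hH (sub_mem (Submodule.smul_mem _ _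
      (hΛH H _ (lin_mem_ctxSpan hgm _))) (lin_mem_ctxSpan (lin_mem_ctxSpan hgm _) _)) ?_
    intro m hm
    have hlw := Ctx.lin_leadsWith ho ((F.subst θ).comp E) (monicize_leadsWith hg0)
    rw [← hw, Ctx.lin_comp] at hlw
    by_cases h0 : R.coeff m = 0
    · refine LeadsWith.coeff_sub_lt (monicize_leadsWith hθ) hlw fun h => hm ?_
      rw [e1, coeff_sub, Finsupp.sub_apply, coeff_smul, Finsupp.smul_apply, h0, smul_zero,
        sub_zero] at h
      exact h
    · exact lt_of_coeff_ne_zero_of_mem_trivialSpan ho hR h0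
  rw [e1]
  exact sub_mem (trivialSpan_mono Set.subset_union_right w h1)
    (Submodule.smul_mem _ _ (trivialSpan_mono Set.subset_union_left w hR))

/-- Were the instance with `u` inserted zero, it would stay zero when the letters of `u` are erased,
and this recovers `φ(θ)`. -/
theorem substOPI_update_mul_ne_zero [DecidableEq X] (ho : IsMonomialOrder o) {φ : FreeOpAlg k X}
    (hφ : IsMultilinearOPI φ) {P₀ : OpWord X} (hP₀ : φ.coeff P₀ ≠ 0)
    (hlead : ∀ θ : X → OpWord Z, substOPI θ φ = 0 ∨ leadMon o (substOPI θ φ) = subst θ P₀)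
    {θ : X → OpWord Z} {x : X} {a u b : OpWord Z} (hab : θ x = a * b) (hu : IsFlat u)
    (hθ : substOPI θ φ ≠ 0) : substOPI (Function.update θ x (a * u * b)) φ ≠ 0 := by
  by_cases hu1 : u = 1
  · rwa [hu1, mul_one, ← hab, Function.update_eq_self]
  obtain ⟨d, -, -⟩ := hu.exists_of_mul hu1
  intro h0
  -- The inserted `u` is written in a second copy of `Z`: identifying the copies gives the vanishing
  -- instance, and sending the second copy to `1` erases `u`. Since `u` is bracket-free, it
  -- disappears completely.
  let θ' : X → OpWord (Z ⊕ Z) := Function.update (fun y => rename Sum.inl (θ y)) x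
    (rename Sum.inl a * rename Sum.inr u * rename Sum.inl b)
  refine hθ ?_
  have h := substOPI_eq_zero_of_rename ho.1 d hφ hP₀ hlead θ' (Sum.elim id id) ?_
    (Sum.elim OpWord.of fun _ => 1)
  · convert h using 2
    congr 1
    funext y
    by_cases hy : y = x
    · subst hy
      simp [θ', subst_rename, hu.subst_one, hab]
    · simp [θ', hy, subst_rename]
  · rw [← h0]
    congr 2
    funext y
    by_cases hy : y = x
    · subst hy
      simp only [θ', Function.update_self, map_mul, rename_rename]
      simp [rename]
    · simp only [θ', Function.update_of_ne hy, rename_rename]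
      simp [rename]

end Union

/-! ### The union is an operated Gröbner–Shirshov basis -/

section Union

variable {k X Z : Type*} [Field k] [o : LinearOrder (OpWord Z)]

/-- If the leading monomial of `φ` is a variable, then `1` is a leading monomial of an instance
of `φ`. -/
theorem exists_leadMon_substOPI_eq_one {φ : FreeOpAlg k X} (hφ : IsMultilinearOPI φ) {x : X}
    (hx : φ.coeff (OpWord.of x) ≠ 0)
    (hlead : ∀ θ : X → OpWord Z, substOPI θ φ = 0 ∨
      leadMon o (substOPI θ φ) = subst θ (OpWord.of x)) :
    ∃ θ : X → OpWord Z, substOPI θ φ ≠ 0 ∧ leadMon o (substOPI θ φ) = 1 := by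
  obtain ⟨V, -, hV⟩ := hφ
  have hVx : ∀ y ∈ V, y = x := by
    intro y hy
    have h := (hV _ (Finsupp.mem_support_iff.2 hx)).1 y hy
    by_contra hne
    simp [count_of, Ne.symm hne] at h
  have hxV : x ∈ V := by
    by_contra h
    have := (hV _ (Finsupp.mem_support_iff.2 hx)).2 x h
    simp at this
  -- At `1` the variable `x` could cancel only against a monomial that becomes `1`. That monomial is
  -- bracket-free and contains `x` once and no other letter, so it is `x`.
  have h0 : substOPI (fun _ => (1 : OpWord Z)) φ ≠ 0 := by
    intro h
    rw [substOPI_eq] at h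
    obtain ⟨m, hm, he, hne⟩ := exists_ne_of_mapDomain_eq_zero h hx
    rw [subst_of] at he
    obtain ⟨h1, h2⟩ := hV m (Finsupp.mem_support_iff.2 hm)
    refine hne (IsFlat.eq_of (isFlat_of_isFlat_subst (he ▸ isFlat_one)) (h1 x hxV) fun y hy => ?_)
    exact hVx y (by_contra fun h => hy (h2 y h))
  exact ⟨_, h0, ((hlead _).resolve_left h0).trans (subst_of _ _)⟩

/-- Only mixed compositions need work. Nonempty bracket-free leading monomials sit inside the value
of one variable, and overlaps are reduced to inclusions by enlarging that value. -/
theorem isOperatedGSBasis_union (ho : IsMonomialOrder o) {Φ : Set (FreeOpAlg k X)}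
    (hΦ : ∀ φ ∈ Φ, IsMultilinearOPI φ) (hGS : IsOperatedGSBasis o (SPhi Φ Z))
    {H : Set (FreeOpAlg k Z)} (hH : IsOperatedGSBasis o H)
    (hflat : ∀ g ∈ H, IsFlat (leadMon o g)) (P : FreeOpAlg k X → OpWord X)
    (hP : ∀ φ ∈ Φ, φ ≠ 0 → φ.coeff (P φ) ≠ 0) (hadj : ∀ φ ∈ Φ, NoAdjacent (P φ))
    (hlead : ∀ φ ∈ Φ, ∀ θ : X → OpWord Z, substOPI θ φ = 0 ∨
      leadMon o (substOPI θ φ) = subst θ (P φ)) :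
    IsOperatedGSBasis o (SPhi Φ Z ∪ H) := by
  classical
  by_cases h1 : ∃ s ∈ SPhi Φ Z ∪ H, s ≠ 0 ∧ leadMon o s = 1
  · obtain ⟨s, hs, hs0, hs1⟩ := h1
    exact isOperatedGSBasis_of_leadMon_eq_one ho hs hs0 hs1
  push Not at h1
  have hPφ : ∀ φ ∈ Φ, ∀ θ : X → OpWord Z, substOPI θ φ ≠ 0 → φ.coeff (P φ) ≠ 0 :=
    fun φ hφ θ hθ => hP φ hφ (by rintro rfl; simp at hθ)
  have hcount : ∀ φ ∈ Φ, ∀ x, φ.coeff (P φ) ≠ 0 → (P φ).count x ≠ 0 →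
      ∀ m, φ.coeff m ≠ 0 → m.count x = 1 := by
    intro φ hφ x h0 hx m hm
    obtain ⟨V, -, hV⟩ := hΦ φ hφ
    have hxV : x ∈ V := by_contra fun h => hx ((hV _ (Finsupp.mem_support_iff.2 h0)).2 x h)
    exact (hV m (Finsupp.mem_support_iff.2 hm)).1 x hxV
  have hGS' := isOperatedGSBasis_iff.1 hGS
  have hH' := isOperatedGSBasis_iff.1 hH
  rw [isOperatedGSBasis_iff]
  rintro f (hf | hf) g (hg | hg) hf0 hg0
  · exact ⟨fun u v e a b c d => trivialSpan_mono Set.subset_union_left _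
        ((hGS' f hf g hg hf0 hg0).1 u v e a b c d),
      fun C e => trivialSpan_mono Set.subset_union_left _ ((hGS' f hf g hg hf0 hg0).2 C e)⟩
  · have hg1 := h1 g (Or.inr hg) hg0
    obtain ⟨φ, hφ, θ, rfl⟩ := hf
    have hPc := hPφ φ hφ θ hf0
    have hle := (hlead φ hφ θ).resolve_left hf0
    constructor
    · intro u v e hv hu hu1 hv1
      obtain ⟨z, rfl, -⟩ | ⟨z, hz, hz'⟩ := levi e
      · rw [breadth_mul] at hv
        omega
      have hfl := isFlat_mul.1 (hz' ▸ hflat g hg)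
      have hz1 : z ≠ 1 := by
        rintro rfl
        rw [hz', one_mul] at hu
        exact lt_irrefl _ hu
      rw [hle] at hz
      obtain ⟨x, m', u', hm', hx⟩ := (hadj φ hφ).exists_suffix hfl.1 hz1 hz
      have hcx := hcount φ hφ x hPc (by simp [hm'])
      have hcx' : m'.count x = 0 := by
        have := hcx _ hPc
        rw [hm', count_mul, count_of_self] at this
        omega
      have hv' : subst θ m' * u' = v := by
        rw [hm', map_mul, subst_of, hx, ← mul_assoc] at hz
        exact mul_right_cancel' hz
      have hF : P φ = (Ctx.flat m' 1).fill (OpWord.of x) := by simp [hm']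
      -- Let `x` be the last variable, whose value ends with the overlap `z`. Replacing `θ x` by `θ
      -- x * u` gives an instance of `φ` led by the whole word `w`.
      have hθ' := substOPI_update_mul_ne_zero ho (hΦ φ hφ) hPc (hlead φ hφ)
        (show θ x = θ x * 1 by simp) hfl.2 hf0
      rw [mul_one] at hθ'
      have hlθ' : leadMon o (substOPI (Function.update θ x (θ x * u)) φ) =
          leadMon o (substOPI θ φ) * u := by
        rw [(hlead φ hφ _).resolve_left hθ', hle, hm', map_mul, map_mul, subst_of, subst_of,
          Function.update_self, subst_update_of_count_eq_zero _ hcx', mul_assoc]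
      have h2 := (hGS' _ ⟨φ, hφ, _, rfl⟩ _ ⟨φ, hφ, θ, rfl⟩ hθ' hf0).2 (Ctx.flat 1 u)
        (by simp [hlθ'])
      have h3 := monicize_substOPI_sub_lin_mem ho hφ hcx (hF ▸ hPc) (hF ▸ hlead φ hφ) hH hg hg0
        hθ' (E := Ctx.flat u' 1) (by simp [hx, hz', mul_assoc])
      -- The enlarged instance cancels between its compositions with `g` and with `φ(θ)`, leaving
      -- the intersection composition.
      have h4 := sub_mem h3 (trivialSpan_mono Set.subset_union_left _ h2)
      rw [hlθ', sub_sub_sub_cancel_left, ← Ctx.lin_comp, Ctx.subst, Ctx.comp,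
        subst_update_of_count_eq_zero _ hcx', hv', map_one, mul_one, Ctx.lin_flat, Ctx.lin_flat,
        map_one, one_mul, mul_one] at h4
      exact h4
    · intro C e
      rw [hle] at e
      obtain ⟨x, F, E, hF, hE, hC⟩ := (hadj φ hφ).exists_ctx (hflat g hg) hg1 e
      have hcx := hcount φ hφ x hPc (by
        rw [hF, ← mem_letters]
        clear hF hC
        induction F with
        | flat u v => simp
        | nest u F v ih => simp [ih])
      have h3 := monicize_substOPI_sub_lin_mem ho hφ hcx (hF ▸ hPc) (hF ▸ hlead φ hφ) hH hg hg0
        hf0 hE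
      rwa [← Ctx.lin_comp, ← Ctx.lin_congr (C := C) (by simpa using hC)] at h3
  · have hf1 := h1 f (Or.inr hf) hf0
    obtain ⟨φ, hφ, θ, rfl⟩ := hg
    have hPc := hPφ φ hφ θ hg0
    have hle := (hlead φ hφ θ).resolve_left hg0
    constructor
    · intro u v e hv hu hu1 hv1
      obtain ⟨z, rfl, -⟩ | ⟨z, hz', hz⟩ := levi e
      · rw [breadth_mul] at hv
        omega
      have hfl := isFlat_mul.1 (hz' ▸ hflat f hf)
      have hz1 : z ≠ 1 := by
        rintro rfl
        rw [hz', mul_one] at hv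
        exact lt_irrefl _ hv
      rw [hle] at hz
      obtain ⟨x, m', u', hm', hx⟩ := (hadj φ hφ).exists_prefix hfl.2 hz1 hz
      have hcx := hcount φ hφ x hPc (by simp [hm'])
      have hcx' : m'.count x = 0 := by
        have := hcx _ hPc
        rw [hm', count_mul, count_of_self] at this
        omega
      have hu' : u' * subst θ m' = u := by
        rw [hm', map_mul, subst_of, hx, mul_assoc] at hz
        exact mul_left_cancel' hz
      have hF : P φ = (Ctx.flat 1 m').fill (OpWord.of x) := by simp [hm']
      have hθ' := substOPI_update_mul_ne_zero ho (hΦ φ hφ) hPc (hlead φ hφ)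
        (show θ x = 1 * θ x by simp) hfl.1 hg0
      rw [one_mul] at hθ'
      have hlθ' : leadMon o (substOPI (Function.update θ x (v * θ x)) φ) =
          v * leadMon o (substOPI θ φ) := by
        rw [(hlead φ hφ _).resolve_left hθ', hle, hm', map_mul, map_mul, subst_of, subst_of,
          Function.update_self, subst_update_of_count_eq_zero _ hcx', mul_assoc]
      have h2 := (hGS' _ ⟨φ, hφ, _, rfl⟩ _ ⟨φ, hφ, θ, rfl⟩ hθ' hg0).2 (Ctx.flat v 1)
        (by simp [hlθ'])
      have h3 := monicize_substOPI_sub_lin_mem ho hφ hcx (hF ▸ hPc) (hF ▸ hlead φ hφ) hH hf hf0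
        hθ' (E := Ctx.flat 1 u') (by simp [hx, hz', mul_assoc])
      have h4 := sub_mem (trivialSpan_mono Set.subset_union_left _ h2) h3
      rw [hlθ', ← e, sub_sub_sub_cancel_left, ← Ctx.lin_comp, Ctx.subst, Ctx.comp,
        subst_update_of_count_eq_zero _ hcx', hu', map_one, mul_one, Ctx.lin_flat, Ctx.lin_flat,
        map_one, one_mul, mul_one] at h4
      exact h4
    · intro C e
      -- A leading monomial of an instance inside a bracket-free word makes `P φ` bracket-free,
      -- hence empty or a single variable. Either way some nonzero instance is led by `1`, which is
      -- excluded.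
      exfalso
      have hfl := isFlat_of_isFlat_fill (e ▸ hflat f hf)
      rw [hle] at hfl
      obtain h | ⟨x, hx⟩ := (hadj φ hφ).eq_one_or_of (isFlat_of_isFlat_subst hfl)
      · exact h1 _ (Or.inl ⟨φ, hφ, θ, rfl⟩) hg0 (by rw [hle, h, map_one])
      · obtain ⟨ρ, hρ0, hρ1⟩ := exists_leadMon_substOPI_eq_one (o := o) (hΦ φ hφ) (hx ▸ hPc)
          (hx ▸ hlead φ hφ)
        exact h1 _ (Or.inl ⟨φ, hφ, ρ, rfl⟩) hρ0 hρ1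
  · exact ⟨fun u v e a b c d => trivialSpan_mono Set.subset_union_right _
        ((hH' f hf g hg hf0 hg0).1 u v e a b c d),
      fun C e => trivialSpan_mono Set.subset_union_right _ ((hH' f hf g hg hf0 hg0).2 C e)⟩

end Union

/-! ### Evaluation of operated polynomials -/

section Eval

variable {k X Z A B : Type*} [Field k] [Ring A] [Algebra k A] [Ring B] [Algebra k B]

theorem evalOPI_single (P : A →ₗ[k] A) (θ : X → A) (m : OpWord X) (c : k) :
    evalOPI P θ (single m c) = c • OpWord.lift P θ m := MonoidAlgebra.lift_single _ _ _

theorem evalOPI_op (P : A →ₗ[k] A) (θ : X → A) (f : FreeOpAlg k X) :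
    evalOPI P θ (FreeOpAlg.op k X f) = P (evalOPI P θ f) := by
  induction f using MonoidAlgebra.induction_linear with
  | zero => simp
  | add f g hf hg => simp only [map_add, hf, hg]
  | single m c => simp [FreeOpAlg.op, evalOPI_single]

theorem map_lift (P : A → A) (Q : B → B) (g : A →* B) (hg : ∀ a, g (P a) = Q (g a)) (θ : X → A)
    (m : OpWord X) : g (OpWord.lift P θ m) = OpWord.lift Q (fun x => g (θ x)) m := by
  induction m using induction_mul with
  | one => simp only [map_one]
  | of_mul z w ih => simp only [map_mul, OpWord.lift_of, ih]
  | brk_mul u w ih1 ih2 => simp only [map_mul, OpWord.lift_brk, hg, ih1, ih2]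

theorem map_evalOPI (P : A →ₗ[k] A) (Q : B →ₗ[k] B) (g : A →ₐ[k] B)
    (hg : ∀ a, g (P a) = Q (g a)) (θ : X → A) (φ : FreeOpAlg k X) :
    g (evalOPI P θ φ) = evalOPI Q (fun x => g (θ x)) φ := by
  induction φ using MonoidAlgebra.induction_linear with
  | zero => simp
  | add f g hf hg => simp only [map_add, hf, hg]
  | single m c =>
    rw [evalOPI_single, evalOPI_single, map_smul]
    exact congrArg (c • ·) (map_lift P Q (g : A →* B) hg θ m)

theorem evalOPI_of (f : FreeOpAlg k X) :
    evalOPI (FreeOpAlg.op k X) (fun x => MonoidAlgebra.of k _ (OpWord.of x)) f = f := by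
  change substOPI OpWord.of f = f
  induction f using MonoidAlgebra.induction_linear with
  | zero => simp
  | add f g hf hg => simp only [map_add, hf, hg]
  | single m c => rw [substOPI_single, subst_of_eq]

/-- A morphism of operated algebras from `k𝔐(X)` is determined by the images of the letters. -/
theorem eq_evalOPI (Q : B →ₗ[k] B) (h : FreeOpAlg k X →ₐ[k] B)
    (hh : ∀ f, h (FreeOpAlg.op k X f) = Q (h f)) :
    h = evalOPI Q fun x => h (MonoidAlgebra.of k _ (OpWord.of x)) := by
  refine AlgHom.ext fun f => ?_
  conv_lhs => rw [← evalOPI_of f]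
  exact map_evalOPI _ _ _ hh _ _

theorem exists_linear_lift_update [DecidableEq X] (P : A →ₗ[k] A) (θ : X → A) {x : X}
    {m : OpWord X} (hm : m.count x = 1) :
    ∃ L : A →ₗ[k] A, ∀ t, OpWord.lift P (Function.update θ x t) m = L t := by
  induction m using induction_mul with
  | one => simp at hm
  | of_mul z w ih =>
    by_cases hz : z = x
    · subst hz
      refine ⟨LinearMap.mulRight k (OpWord.lift P θ w), fun t => ?_⟩
      have hw : w.count z = 0 := by
        rw [count_mul, count_of_self] at hm
        omega
      rw [map_mul, OpWord.lift_of, Function.update_self, lift_update_of_count_eq_zero _ _ hw]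
      rfl
    · obtain ⟨L, hL⟩ := ih (by simpa [count_of, hz] using hm)
      refine ⟨LinearMap.mulLeft k (θ z) ∘ₗ L, fun t => ?_⟩
      rw [map_mul, OpWord.lift_of, Function.update_of_ne hz, hL]
      rfl
  | brk_mul u w ih1 ih2 =>
    rw [count_mul, count_brk] at hm
    obtain ⟨hu, hw⟩ | ⟨hu, hw⟩ : (u.count x = 1 ∧ w.count x = 0) ∨
        (u.count x = 0 ∧ w.count x = 1) := by omega
    · obtain ⟨L, hL⟩ := ih1 hu
      refine ⟨LinearMap.mulRight k (OpWord.lift P θ w) ∘ₗ P ∘ₗ L, fun t => ?_⟩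
      rw [map_mul, OpWord.lift_brk, hL, lift_update_of_count_eq_zero _ _ hw]
      rfl
    · obtain ⟨L, hL⟩ := ih2 hw
      refine ⟨LinearMap.mulLeft k (P (OpWord.lift P θ u)) ∘ₗ L, fun t => ?_⟩
      rw [map_mul, OpWord.lift_brk, hL, lift_update_of_count_eq_zero _ _ hu]
      rfl

theorem exists_linear_evalOPI_update [DecidableEq X] (P : A →ₗ[k] A) (θ : X → A) {x : X}
    {φ : FreeOpAlg k X} (hφ : ∀ m, φ.coeff m ≠ 0 → m.count x = 1) :
    ∃ L : A →ₗ[k] A, ∀ t, evalOPI P (Function.update θ x t) φ = L t := by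
  have hL : ∀ m, ∃ L : A →ₗ[k] A, φ.coeff m ≠ 0 →
      ∀ t, OpWord.lift P (Function.update θ x t) m = L t := by
    intro m
    by_cases hm : φ.coeff m = 0
    · exact ⟨0, fun h => absurd hm h⟩
    · obtain ⟨L, hL⟩ := exists_linear_lift_update P θ (hφ m hm)
      exact ⟨L, fun _ => hL⟩
  choose L hL using hL
  refine ⟨∑ m ∈ φ.coeff.support, φ.coeff m • L m, fun t => ?_⟩
  conv_lhs => rw [← sum_coeff_single φ, Finsupp.sum, map_sum]
  rw [LinearMap.sum_apply]
  refine Finset.sum_congr rfl fun m hm => ?_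
  rw [evalOPI_single, hL m (Finsupp.mem_support_iff.1 hm), LinearMap.smul_apply]

theorem evalOPI_congr (P : A →ₗ[k] A) {θ ρ : X → A} {φ : FreeOpAlg k X}
    (h : ∀ m, φ.coeff m ≠ 0 → ∀ x, m.count x ≠ 0 → θ x = ρ x) :
    evalOPI P θ φ = evalOPI P ρ φ := by
  rw [← sum_coeff_single φ, Finsupp.sum, map_sum, map_sum]
  refine Finset.sum_congr rfl fun m hm => ?_
  rw [evalOPI_single, evalOPI_single, lift_congr P (h m (Finsupp.mem_support_iff.1 hm))]

/-- The values of a multilinear identity at elements of `k𝔐(Z)` are linear combinations of its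
values at words. -/
theorem evalOPI_mem_of_multilinear {φ : FreeOpAlg k X} (hφ : IsMultilinearOPI φ)
    (J : Submodule k (FreeOpAlg k Z)) (hJ : ∀ θ : X → OpWord Z, substOPI θ φ ∈ J)
    (f : X → FreeOpAlg k Z) : evalOPI (FreeOpAlg.op k Z) f φ ∈ J := by
  classical
  obtain ⟨V, -, hV⟩ := hφ
  -- `T` contains the variables whose values need not be words; linearity in one of them at a time
  -- shrinks it.
  have key : ∀ T : Finset X, T ⊆ V → ∀ f : X → FreeOpAlg k Z,
      (∀ x ∉ T, ∃ u, f x = MonoidAlgebra.of k _ u) → evalOPI (FreeOpAlg.op k Z) f φ ∈ J := by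
    intro T
    induction T using Finset.induction_on with
    | empty =>
      intro _ f hf
      choose u hu using fun x => hf x (Finset.notMem_empty x)
      rw [funext hu]
      exact hJ u
    | insert x T _ ih =>
      intro hT f hf
      obtain ⟨L, hL⟩ := exists_linear_evalOPI_update (FreeOpAlg.op k Z) f (x := x) (φ := φ)
        fun m hm => (hV m (Finsupp.mem_support_iff.2 hm)).1 x (hT (Finset.mem_insert_self x T))
      have h := hL (f x)
      rw [Function.update_eq_self] at h
      rw [h]
      refine map_mem_of_forall_single_mem L J fun m _ => ?_
      rw [← hL]
      refine ih (fun y hy => hT (Finset.mem_insert_of_mem hy)) _ fun y hy => ?_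
      by_cases hyx : y = x
      · subst hyx
        exact ⟨m, by simp⟩
      · rw [Function.update_of_ne hyx]
        exact hf y (by simp [hyx, hy])
  -- Letters outside `V` do not occur in `φ`, so their values may be reset to the word `1`.
  have h := key V subset_rfl (fun x => if x ∈ V then f x else 1) fun x hx => ⟨1, by simp [hx, one_def]⟩
  rwa [evalOPI_congr (ρ := f)] at h
  intro m hm x hx
  have hxV : x ∈ V := by_contra fun h => hx ((hV m (Finsupp.mem_support_iff.2 hm)).2 x h)
  simp [hxV]

end Eval

/-! ### Operated ideals -/

section OperatedIdeal

variable {k A : Type*} [Field k] [Ring A] [Algebra k A]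

theorem subset_operatedSpan (P : A →ₗ[k] A) {S : Set A} {a : A} (ha : a ∈ S) :
    a ∈ operatedSpan P S := by
  rw [operatedSpan, TwoSidedIdeal.mem_sInf]
  exact fun I hI => hI.1 ha

theorem operatedSpan_le (P : A →ₗ[k] A) {S : Set A} {I : TwoSidedIdeal A} (hS : S ⊆ I)
    (hI : ∀ a ∈ I, P a ∈ I) : operatedSpan P S ≤ I :=
  sInf_le ⟨hS, hI⟩

theorem OpQuot.mk_eq_zero (P : A →ₗ[k] A) (S : Set A) {a : A} :
    OpQuot.mk P S a = 0 ↔ a ∈ operatedSpan P S :=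
  (RingCon.eq _).trans (TwoSidedIdeal.mem_iff _ _).symm

theorem OpQuot.mk_surjective (P : A →ₗ[k] A) (S : Set A) :
    Function.Surjective (OpQuot.mk P S) :=
  RingCon.mkₐ_surjective _

variable {Z : Type*}

theorem mul_mem_ctxSpan_left {G : Set (FreeOpAlg k Z)} {f : FreeOpAlg k Z} (hf : f ∈ ctxSpan G)
    (g : FreeOpAlg k Z) : g * f ∈ ctxSpan G := by
  refine map_mem_of_forall_single_mem (LinearMap.mulRight k f) _ fun m _ => ?_
  have := lin_mem_ctxSpan hf (Ctx.flat m 1)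
  rwa [Ctx.lin_flat, map_one, mul_one] at this

theorem mul_mem_ctxSpan_right {G : Set (FreeOpAlg k Z)} {f : FreeOpAlg k Z} (hf : f ∈ ctxSpan G)
    (g : FreeOpAlg k Z) : f * g ∈ ctxSpan G := by
  refine map_mem_of_forall_single_mem (LinearMap.mulLeft k f) _ fun m _ => ?_
  have := lin_mem_ctxSpan hf (Ctx.flat 1 m)
  rwa [Ctx.lin_flat, map_one, one_mul] at this

theorem op_mem_ctxSpan {G : Set (FreeOpAlg k Z)} {f : FreeOpAlg k Z} (hf : f ∈ ctxSpan G) :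
    FreeOpAlg.op k Z f ∈ ctxSpan G := by
  have := lin_mem_ctxSpan hf (Ctx.nest 1 (Ctx.flat 1 1) 1)
  simpa only [Ctx.lin_nest, Ctx.lin_flat, map_one, one_mul, mul_one] using this

/-- The operated ideal generated by `G`, described by contexts. -/
theorem mem_operatedSpan_iff {G : Set (FreeOpAlg k Z)} {f : FreeOpAlg k Z} :
    f ∈ operatedSpan (FreeOpAlg.op k Z) G ↔ f ∈ ctxSpan G := by
  constructor
  · let I : TwoSidedIdeal (FreeOpAlg k Z) := TwoSidedIdeal.mk' (ctxSpan G : Set (FreeOpAlg k Z))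
      (zero_mem _) (fun ha hb => add_mem ha hb) (fun ha => neg_mem ha)
      (fun ha => mul_mem_ctxSpan_left ha _) (fun ha => mul_mem_ctxSpan_right ha _)
    have hI : ∀ a, a ∈ I ↔ a ∈ ctxSpan G := fun a => TwoSidedIdeal.mem_mk' _ _ _ _ _ _ a
    intro hf
    refine (hI f).1 (operatedSpan_le _ (fun a ha => (hI a).2 (subset_ctxSpan G ha))
      (fun a ha => (hI _).2 (op_mem_ctxSpan ((hI a).1 ha))) hf)
  · intro hf
    induction hf using Submodule.span_induction with
    | mem x hx =>
      obtain ⟨s, hs, C, rfl⟩ := hx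
      induction C with
      | flat u v =>
        rw [Ctx.lin_flat]
        exact TwoSidedIdeal.mul_mem_right _ _ _
          (TwoSidedIdeal.mul_mem_left _ _ _ (subset_operatedSpan _ hs))
      | nest u C v ih =>
        rw [Ctx.lin_nest]
        exact TwoSidedIdeal.mul_mem_right _ _ _
          (TwoSidedIdeal.mul_mem_left _ _ _ (operatedSpan_op_mem _ _ ih))
    | zero => exact TwoSidedIdeal.zero_mem _
    | add x y _ _ hx hy => exact TwoSidedIdeal.add_mem _ hx hy
    | smul c x _ hx =>
      rw [Algebra.smul_def]
      exact TwoSidedIdeal.mul_mem_left _ _ _ hx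

end OperatedIdeal

/-! ### The free `Φ`-algebra over an algebra -/

section Free

variable {k : Type uk} {X : Type ux} {Z : Type uz} [Field k] (Φ : Set (FreeOpAlg k X))

/-- The preimage in `k𝓜(Z)` of an operated ideal is a two-sided ideal, so it contains the ideal
generated by `G` as soon as it contains `G`. -/
theorem operatedSpan_phiRel_span (G : Set (MonoidAlgebra k (FreeMonoid Z))) {f : FreeOpAlg k Z} :
    f ∈ operatedSpan (FreeOpAlg.op k Z) (phiRel Φ (TwoSidedIdeal.span G)) ↔
      f ∈ ctxSpan (SPhi Φ Z ∪ freeAlgIncl k Z '' G) := by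
  rw [← mem_operatedSpan_iff]
  constructor
  · intro hf
    refine operatedSpan_le _ ?_ (fun a ha => operatedSpan_op_mem _ _ ha) hf
    rintro a (ha | ⟨a, ha, rfl⟩)
    · exact subset_operatedSpan _ (Or.inl ha)
    · have h : TwoSidedIdeal.span G ≤ TwoSidedIdeal.comap (freeAlgIncl k Z)
          (operatedSpan (FreeOpAlg.op k Z) (SPhi Φ Z ∪ freeAlgIncl k Z '' G)) := by
        rw [TwoSidedIdeal.span_le]
        intro g hg
        exact (TwoSidedIdeal.mem_comap _).2 (subset_operatedSpan _ (Or.inr ⟨g, hg, rfl⟩))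
      exact (TwoSidedIdeal.mem_comap _).1 (h ha)
  · intro hf
    refine operatedSpan_le _ ?_ (fun a ha => operatedSpan_op_mem _ _ ha) hf
    rintro a (ha | ⟨g, hg, rfl⟩)
    · exact subset_operatedSpan _ (Or.inl ha)
    · exact subset_operatedSpan _ (Or.inr ⟨g, TwoSidedIdeal.subset_span hg, rfl⟩)

variable (IA : TwoSidedIdeal (MonoidAlgebra k (FreeMonoid Z)))

theorem isPhiAlgebra_phiQuot (hΦ : ∀ φ ∈ Φ, IsMultilinearOPI φ) :
    IsPhiAlgebra Φ (PhiQuot.op Φ IA) := by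
  intro φ hφ θ
  choose f hf using fun x => OpQuot.mk_surjective (FreeOpAlg.op k Z) (phiRel Φ IA) (θ x)
  have h := map_evalOPI (FreeOpAlg.op k Z) (PhiQuot.op Φ IA) (PhiQuot.mk Φ IA)
    (fun a => rfl) f φ
  rw [show θ = fun x => PhiQuot.mk Φ IA (f x) from funext fun x => (hf x).symm, ← h]
  refine (OpQuot.mk_eq_zero _ _).2 (mem_operatedSpan_iff.2 ?_)
  exact evalOPI_mem_of_multilinear (hΦ φ hφ) _
    (fun θ => subset_ctxSpan _ (Or.inl ⟨φ, hφ, θ, rfl⟩)) f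

/-- The homomorphism from `A` to the quotient induced by `k𝓜(Z) ⊆ k𝔐(Z)`. -/
def phiQuotIncl : IA.ringCon.Quotient →ₐ[k] PhiQuot Φ IA :=
  IA.ringCon.liftₐ ((PhiQuot.mk Φ IA).comp (freeAlgIncl k Z)) fun a b hab => by
    have h : a - b ∈ IA := (TwoSidedIdeal.rel_iff IA a b).1 hab
    have h' : PhiQuot.mk Φ IA (freeAlgIncl k Z (a - b)) = 0 :=
      (OpQuot.mk_eq_zero _ _).2 (subset_operatedSpan _ (Or.inr ⟨_, h, rfl⟩))
    rw [map_sub, map_sub, sub_eq_zero] at h'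
    exact h'

theorem phiQuotIncl_mk (f : MonoidAlgebra k (FreeMonoid Z)) :
    phiQuotIncl Φ IA (IA.ringCon.mkₐ (α := k) f) = PhiQuot.mk Φ IA (freeAlgIncl k Z f) := rfl

/-- Evaluation at the images of the letters under `f` kills both kinds of relations, so it descends
to the quotient. Uniqueness holds because a morphism of operated algebras on `k𝔐(Z)` is determined
by the letters, whose images `f` prescribes. -/
theorem exists_phiQuot_lift {B : Type ub} [Ring B] [Algebra k B] (PB : B →ₗ[k] B)
    (hB : IsPhiAlgebra Φ PB) (f : IA.ringCon.Quotient →ₐ[k] B) :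
    ∃! g : PhiQuot Φ IA →ₐ[k] B,
      (∀ a, g (PhiQuot.op Φ IA a) = PB (g a)) ∧ g.comp (phiQuotIncl Φ IA) = f := by
  let ev : FreeOpAlg k Z →ₐ[k] B :=
    evalOPI PB fun z => f (IA.ringCon.mkₐ (α := k) (MonoidAlgebra.of k _ (FreeMonoid.of z)))
  have hincl : ev.comp (freeAlgIncl k Z) = f.comp (IA.ringCon.mkₐ (α := k)) := by
    refine MonoidAlgebra.algHom_ext' ?_ ?_
    · refine FreeMonoid.hom_eq fun z => ?_
      change evalOPI PB _ (freeAlgIncl k Z (single (FreeMonoid.of z) 1)) = _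
      rw [freeAlgIncl_single, ofFree_of, evalOPI_single, one_smul, OpWord.lift_of]
      rfl
    · exact Subsingleton.elim _ _
  have hker : operatedSpan (FreeOpAlg.op k Z) (phiRel Φ IA) ≤ TwoSidedIdeal.ker ev := by
    refine operatedSpan_le _ ?_ fun a ha => ?_
    · rintro a (⟨φ, hφ, θ, rfl⟩ | ⟨a, ha, rfl⟩)
      · refine (TwoSidedIdeal.mem_ker _).2 ?_
        rw [substOPI, map_evalOPI _ PB ev (evalOPI_op PB _)]
        exact hB φ hφ _
      · refine (TwoSidedIdeal.mem_ker _).2 ?_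
        have h := DFunLike.congr_fun hincl a
        rw [AlgHom.comp_apply, AlgHom.comp_apply] at h
        have h0 : IA.ringCon.mkₐ (α := k) a = 0 := (RingCon.eq _).2 ((TwoSidedIdeal.mem_iff _ _).1 ha)
        rw [h, h0, map_zero]
    · rw [TwoSidedIdeal.mem_ker] at ha ⊢
      rw [evalOPI_op, ha, map_zero]
  let g : PhiQuot Φ IA →ₐ[k] B :=
    (operatedSpan (FreeOpAlg.op k Z) (phiRel Φ IA)).ringCon.liftₐ ev fun a b hab => by
      have h := hker ((TwoSidedIdeal.rel_iff _ a b).1 hab)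
      rw [TwoSidedIdeal.mem_ker, map_sub, sub_eq_zero] at h
      exact h
  refine ⟨g, ⟨fun a => ?_, AlgHom.ext fun a => ?_⟩, ?_⟩
  · obtain ⟨a, rfl⟩ := OpQuot.mk_surjective _ _ a
    exact evalOPI_op PB _ a
  · obtain ⟨a, rfl⟩ := RingCon.mkₐ_surjective (α := k) IA.ringCon a
    exact DFunLike.congr_fun hincl a
  · rintro g' ⟨hg1, hg2⟩
    have h : g'.comp (PhiQuot.mk Φ IA) = ev := by
      rw [eq_evalOPI PB (g'.comp (PhiQuot.mk Φ IA)) fun a => hg1 (PhiQuot.mk Φ IA a)]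
      congr 1
      funext z
      rw [← hg2, AlgHom.comp_apply, AlgHom.comp_apply, phiQuotIncl_mk, freeAlgIncl_of, ofFree_of]
    refine AlgHom.ext fun a => ?_
    obtain ⟨a, rfl⟩ := OpQuot.mk_surjective _ _ a
    exact DFunLike.congr_fun h a

end Free

/-! ### The main theorem -/

theorem noAdjacent_of_forall_not_isSubword {X : Type*} {m : OpWord X}
    (h : ∀ v : FreeMonoid X, 2 ≤ v.length → ¬ IsSubword (OpWord.ofFree X v) m) :
    NoAdjacent m := by
  rintro C x y rfl
  obtain ⟨q, hq⟩ := Ctx.exists_starWord_fill_eq C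
  exact h (FreeMonoid.of x * FreeMonoid.of y) (by simp) ⟨q, by simp [hq]⟩

end

theorem mainTheorem2 {k : Type uk} [Field k] {X : Type ux} {Z : Type uz}
    -- a system of multilinear operated polynomial identities
    (Φ : Set (FreeOpAlg k X)) (hΦ : ∀ φ ∈ Φ, IsMultilinearOPI φ)
    -- the algebra `A = k𝓜(Z) / I_A` with generating set `Z`
    (IA : TwoSidedIdeal (MonoidAlgebra k (FreeMonoid Z)))
    -- a monomial order on `𝔐(Z)` for which `Φ` is operated GS on `Z`
    (o : LinearOrder (OpWord Z)) (ho : IsMonomialOrder o)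
    (hGS : IsOperatedGSBasis o (SPhi Φ Z))
    -- a GS basis `G` of `I_A` with respect to the restricted order
    (G : Set (MonoidAlgebra k (FreeMonoid Z)))
    (hG : IsGSBasisAssoc (restrictOrder o) G) (hGI : TwoSidedIdeal.span G = IA)
    -- the linear order on `𝔐(X)` which defines the leading monomials of the identities
    (oX : LinearOrder (OpWord X))
    (hsub : ∀ φ ∈ Φ, ∀ v : FreeMonoid X, 2 ≤ v.length →
      ¬ IsSubword (OpWord.ofFree X v) (leadMon oX φ))
    (hlead : ∀ φ ∈ Φ, ∀ θ : X → OpWord Z, substOPI θ φ = 0 ∨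
      leadMon o (substOPI θ φ) = OpWord.subst θ (leadMon oX φ)) :
    -- `k𝔐(Z) / ⟨S_Φ(Z) ∪ I_A⟩` is the free `Φ`-algebra over `A`
    (∃ ι : IA.ringCon.Quotient →ₐ[k] PhiQuot Φ IA,
      (∀ f : MonoidAlgebra k (FreeMonoid Z),
        ι (IA.ringCon.mkₐ (α := k) f) = PhiQuot.mk Φ IA (freeAlgIncl k Z f)) ∧
      IsFreePhiAlgebra.{uk, ux, max uk uz, max uk uz, ub} Φ (PhiQuot.op Φ IA) ι) ∧
    -- the images under `η` of the irreducible words form a `k`-basis of it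
    (∃ b : Module.Basis (Irr o (SPhi Φ Z ∪ freeAlgIncl k Z '' G)) k (PhiQuot Φ IA),
      ∀ m, b m = PhiQuot.mk Φ IA (MonoidAlgebra.of k (OpWord Z) m.1)) := by
  subst hGI
  refine ⟨⟨phiQuotIncl Φ _, phiQuotIncl_mk Φ _, isPhiAlgebra_phiQuot Φ _ hΦ,
    fun B _ _ PB hB f => exists_phiQuot_lift Φ _ PB hB f⟩, ?_⟩
  have hU : IsOperatedGSBasis o (SPhi Φ Z ∪ freeAlgIncl k Z '' G) := by
    refine isOperatedGSBasis_union ho hΦ hGS (isOperatedGSBasis_freeAlgIncl hG) ?_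
      (fun φ => leadMon oX φ) (fun φ _ h => leadMon_mem_support (o := oX) h)
      (fun φ hφ => noAdjacent_of_forall_not_isSubword (hsub φ hφ)) hlead
    rintro _ ⟨g, -, rfl⟩
    rw [leadMon_freeAlgIncl]
    exact OpWord.isFlat_ofFree _
  refine exists_basis_irr ho hU (PhiQuot.mk Φ (TwoSidedIdeal.span G)).toLinearMap
    (OpQuot.mk_surjective _ _) ?_
  ext f
  rw [LinearMap.mem_ker, ← operatedSpan_phiRel_span]
  exact OpQuot.mk_eq_zero _ _
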